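/- Let $d\ge 1$, let $\Omega\subset\mathbb R^d$ be a bounded domain (non-empty, open, connected) with a Lipschitz boundary, and let $0<s\le 1$ and $1<p<\infty$ satisfy $sp>d$. Let $W^{s,p}(\Omega)$ be the Sobolev space of all $u\in L^p(\Omega)$ with $|u|_{s,p}<\infty$, normed by $(\|u\|_{L^p(\Omega)}^p+|u|_{s,p}^p)^{1/p}$, where $$|u|_{s,p}^p=\int_\Omega\int_\Omega\frac{|u(x)-u(y)|^p}{|x-y|^{d+sp}}\,dx\,dy\quad(0<s<1),\qquad |u|_{1,p}=\|\nabla u\|_{L^p(\Omega)}$$ with the weak gradient $\nabla u$ (and $|u|_{1,p}=\infty$ if there is no weak gradient in $L^p(\Omega)$). Let $$M=\{q\in L^\infty(\Omega) : -1\le q\le 1 \text{ a.e. in }\Omega\},$$ regarded as a subset of the dual space $W^{s,p}(\Omega)^\star$ by identifying $q$ with the functional $v\mapsto\int_\Omega q\,v\,dx$. Then $M$ is a closed, convex and non-empty subset of $W^{s,p}(\Omega)^\star$ which is not polyhedric. Here a closed, convex, non-empty subset $K$ of a Banach space $W$ is called polyhedric if, for every $w\in K$ and every $\eta\in\mathcal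 N_K(w)$, $$\mathcal T_K(w)\cap\ker\eta=\overline{\mathcal R_K(w)\cap\ker\eta},$$ where $\mathcal R_K(w)=\{t(k-w): t>0,\ k\in K\}$, $\mathcal T_K(w)=\overline{\mathcal R_K(w)}$ and $\mathcal N_K(w)=\{\eta\in W^\star : \eta(x)\le 0 \text{ for all } x\in\mathcal T_K(w)\}$ are the radial, tangent and normal cones. -/

import Mathlib

open MeasureTheory Set Filter Topology
open scoped ENNReal ContDiff

noncomputable section

/-! ### Cones and polyhedric sets -/

section Cones

variable {W : Type*} [NormedAddCommGroup W] [NormedSpace ℝ W]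

/-- The radial cone `ℝ⁺ (K - w)`. -/
def radialCone (K : Set W) (w : W) : Set W :=
  {x | ∃ t : ℝ, 0 < t ∧ ∃ k ∈ K, x = t • (k - w)}

/-- The tangent cone: the closure of the radial cone. -/
def tangentCone (K : Set W) (w : W) : Set W :=
  closure (radialCone K w)

/-- The polar cone of `C`, a subset of the dual space. -/
def polarCone (C : Set W) : Set (StrongDual ℝ W) :=
  {η | ∀ x ∈ C, η x ≤ 0}

/-- The normal cone: the polar of the tangent cone. -/
def normalCone (K : Set W) (w : W) : Set (StrongDual ℝ W) :=
  polarCone (tangentCone K w)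

/-- The kernel of a functional. -/
def annihilator (η : StrongDual ℝ W) : Set W :=
  {x | η x = 0}

/-- `K` is polyhedric at `w` with respect to `η`. -/
def IsPolyhedricAt (K : Set W) (w : W) (η : StrongDual ℝ W) : Prop :=
  tangentCone K w ∩ annihilator η = closure (radialCone K w ∩ annihilator η)

/-- `K` (understood to be closed, convex and non-empty) is polyhedric. -/
def IsPolyhedric (K : Set W) : Prop :=
  ∀ w ∈ K, ∀ η ∈ normalCone K w, IsPolyhedricAt K w η

end Cones

/-! ### Bounded Lipschitz domains -/

/-- A bounded domain (non-empty, connected, open set) with a Lipschitz boundary: near each boundary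
point, in suitable Cartesian coordinates with `e` as the vertical direction, the set is the
strict supergraph of a Lipschitz function of the horizontal component `z - ⟪e, z⟫ e`. -/
structure IsBoundedLipschitzDomain {d : ℕ} (Ω : Set (EuclideanSpace ℝ (Fin d))) : Prop where
  isOpen : IsOpen Ω
  isConnected : IsConnected Ω
  isBounded : Bornology.IsBounded Ω
  lipschitz_boundary : ∀ x ∈ frontier Ω,
    ∃ e : EuclideanSpace ℝ (Fin d), ‖e‖ = 1 ∧
      ∃ (γ : EuclideanSpace ℝ (Fin d) → ℝ) (L : NNReal), LipschitzWith L γ ∧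
        ∃ r : ℝ, 0 < r ∧ ∀ z ∈ Metric.ball x r,
          (z ∈ Ω ↔ γ (z - (inner ℝ e z) • e) < inner ℝ e z)

/-! ### Sobolev(-Slobodeckij) spaces `W^{s,p}(Ω)`, `0 < s ≤ 1`, `1 < p < ∞` -/

section Sobolev

variable {d : ℕ}

/-- `g` is a weak (distributional) gradient of `u` in the open set `Ω`. -/
def IsWeakGradient (Ω : Set (EuclideanSpace ℝ (Fin d)))
    (u : EuclideanSpace ℝ (Fin d) → ℝ)
    (g : EuclideanSpace ℝ (Fin d) → EuclideanSpace ℝ (Fin d)) : Prop :=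
  ∀ φ : EuclideanSpace ℝ (Fin d) → ℝ, ContDiff ℝ ∞ φ → HasCompactSupport φ → tsupport φ ⊆ Ω →
    ∀ i : Fin d, ∫ x in Ω, u x * fderiv ℝ φ x (EuclideanSpace.single i 1) =
      - ∫ x in Ω, g x i * φ x

/-- The quotient `(u x - u y) / |x - y| ^ (d / p + s)`, whose `L^p(Ω × Ω)` norm is
the Gagliardo seminorm of `u`. -/
def gagliardoQuotient (s p : ℝ) (u : EuclideanSpace ℝ (Fin d) → ℝ)
    (z : EuclideanSpace ℝ (Fin d) × EuclideanSpace ℝ (Fin d)) : ℝ :=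
  (u z.1 - u z.2) / ‖z.1 - z.2‖ ^ ((d : ℝ) / p + s)

/-- The `W^{s,p}` seminorm with values in `[0, ∞]`. For `s = 1` it is the `L^p` norm of the weak
gradient (the weak gradient is unique up to null sets, and the infimum is `∞` if there
is no weak gradient in `L^p`); for `0 < s < 1` it is the Gagliardo seminorm
`(∫_Ω ∫_Ω |u x - u y|^p / |x - y|^(d + s p) dx dy)^(1/p)`. -/
def sobolevSeminorm (Ω : Set (EuclideanSpace ℝ (Fin d))) (s p : ℝ)
    (u : EuclideanSpace ℝ (Fin d) → ℝ) : ℝ≥0∞ :=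
  if s = 1 then
    ⨅ (g : EuclideanSpace ℝ (Fin d) → EuclideanSpace ℝ (Fin d))
      (_ : MemLp g (ENNReal.ofReal p) (volume.restrict Ω) ∧ IsWeakGradient Ω u g),
      eLpNorm g (ENNReal.ofReal p) (volume.restrict Ω)
  else
    eLpNorm (gagliardoQuotient s p u) (ENNReal.ofReal p)
      ((volume.restrict Ω).prod (volume.restrict Ω))

instance factOneLeOfReal (p : ℝ) [hp : Fact (1 < p)] : Fact (1 ≤ ENNReal.ofReal p) :=
  ⟨by simpa using hp.out.le⟩

theorem IsWeakGradient.congr {Ω : Set (EuclideanSpace ℝ (Fin d))}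
    {u v : EuclideanSpace ℝ (Fin d) → ℝ}
    {g : EuclideanSpace ℝ (Fin d) → EuclideanSpace ℝ (Fin d)}
    (h : IsWeakGradient Ω u g) (huv : u =ᵐ[volume.restrict Ω] v) : IsWeakGradient Ω v g := by
  intro φ h1 h2 h3 i
  rw [← h φ h1 h2 h3 i]
  refine integral_congr_ae ?_
  filter_upwards [huv] with x hx
  rw [hx]

theorem IsWeakGradient.add {p : ℝ} [Fact (1 < p)] {Ω : Set (EuclideanSpace ℝ (Fin d))}
    {u v : EuclideanSpace ℝ (Fin d) → ℝ}
    {g k : EuclideanSpace ℝ (Fin d) → EuclideanSpace ℝ (Fin d)}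
    (hu : MemLp u (ENNReal.ofReal p) (volume.restrict Ω))
    (hv : MemLp v (ENNReal.ofReal p) (volume.restrict Ω))
    (hg : MemLp g (ENNReal.ofReal p) (volume.restrict Ω))
    (hk : MemLp k (ENNReal.ofReal p) (volume.restrict Ω))
    (h : IsWeakGradient Ω u g) (h' : IsWeakGradient Ω v k) :
    IsWeakGradient Ω (u + v) (g + k) := by
  intro φ h1 h2 h3 i
  have key : ∀ {f ψ : EuclideanSpace ℝ (Fin d) → ℝ},
      MemLp f (ENNReal.ofReal p) (volume.restrict Ω) → Continuous ψ → HasCompactSupport ψ →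
      Integrable (fun x => f x * ψ x) (volume.restrict Ω) := by
    intro f ψ hf hψ hc
    have hl : LocallyIntegrable f (volume.restrict Ω) := hf.locallyIntegrable Fact.out
    simpa [mul_comm] using hl.integrable_smul_left_of_hasCompactSupport hψ hc
  have hder : Continuous fun x => fderiv ℝ φ x (EuclideanSpace.single i 1) :=
    (h1.continuous_fderiv (by simp)).clm_apply continuous_const
  have hdc : HasCompactSupport fun x => fderiv ℝ φ x (EuclideanSpace.single i 1) :=
    h2.fderiv_apply (𝕜 := ℝ) _
  have coord : ∀ {f : EuclideanSpace ℝ (Fin d) → EuclideanSpace ℝ (Fin d)},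
      MemLp f (ENNReal.ofReal p) (volume.restrict Ω) →
      MemLp (fun x => f x i) (ENNReal.ofReal p) (volume.restrict Ω) := fun {f} hf =>
    (EuclideanSpace.proj (𝕜 := ℝ) i).comp_memLp' hf
  have e1 : ∀ x, (u + v) x * fderiv ℝ φ x (EuclideanSpace.single i 1) =
      u x * fderiv ℝ φ x (EuclideanSpace.single i 1) +
      v x * fderiv ℝ φ x (EuclideanSpace.single i 1) := fun x => by
    simp [add_mul]
  have e2 : ∀ x, (g + k) x i * φ x = g x i * φ x + k x i * φ x := fun x => by simp [add_mul]
  simp only [e1, e2]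
  rw [integral_add (key hu hder hdc) (key hv hder hdc),
    integral_add (key (coord hg) h1.continuous h2) (key (coord hk) h1.continuous h2),
    h φ h1 h2 h3 i, h' φ h1 h2 h3 i]
  ring

theorem IsWeakGradient.const_smul {Ω : Set (EuclideanSpace ℝ (Fin d))}
    {u : EuclideanSpace ℝ (Fin d) → ℝ}
    {g : EuclideanSpace ℝ (Fin d) → EuclideanSpace ℝ (Fin d)} (c : ℝ)
    (h : IsWeakGradient Ω u g) : IsWeakGradient Ω (c • u) (c • g) := by
  intro φ h1 h2 h3 i
  have e1 : ∀ x, (c • u) x * fderiv ℝ φ x (EuclideanSpace.single i 1) =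
      c * (u x * fderiv ℝ φ x (EuclideanSpace.single i 1)) := fun x => by
    simp [mul_assoc]
  have e2 : ∀ x, (c • g) x i * φ x = c * (g x i * φ x) := fun x => by simp [mul_assoc]
  simp only [e1, e2, integral_const_mul]
  rw [h φ h1 h2 h3 i]
  ring

theorem sobolevSeminorm_congr {Ω : Set (EuclideanSpace ℝ (Fin d))} {s p : ℝ}
    {u v : EuclideanSpace ℝ (Fin d) → ℝ} (huv : u =ᵐ[volume.restrict Ω] v) :
    sobolevSeminorm Ω s p u = sobolevSeminorm Ω s p v := by
  unfold sobolevSeminorm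
  split_ifs with hs
  · have : ∀ g, IsWeakGradient Ω u g ↔ IsWeakGradient Ω v g := fun g =>
      ⟨fun h => h.congr huv, fun h => h.congr huv.symm⟩
    simp only [this]
  · refine eLpNorm_congr_ae ?_
    have h1 := (Measure.quasiMeasurePreserving_fst (μ := volume.restrict Ω)
      (ν := volume.restrict Ω)).ae_eq_comp huv
    have h2 := (Measure.quasiMeasurePreserving_snd (μ := volume.restrict Ω)
      (ν := volume.restrict Ω)).ae_eq_comp huv
    filter_upwards [h1, h2] with z hz1 hz2
    simp only [Function.comp_apply] at hz1 hz2
    simp only [gagliardoQuotient, hz1, hz2]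

theorem sobolevSeminorm_zero {Ω : Set (EuclideanSpace ℝ (Fin d))} {s p : ℝ} :
    sobolevSeminorm Ω s p (0 : EuclideanSpace ℝ (Fin d) → ℝ) = 0 := by
  unfold sobolevSeminorm
  split_ifs with hs
  · refine le_antisymm ?_ bot_le
    have h : MemLp (0 : EuclideanSpace ℝ (Fin d) → EuclideanSpace ℝ (Fin d))
        (ENNReal.ofReal p) (volume.restrict Ω) ∧
        IsWeakGradient Ω 0 (0 : EuclideanSpace ℝ (Fin d) → EuclideanSpace ℝ (Fin d)) :=
      ⟨MemLp.zero, fun φ _ _ _ i => by simp⟩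
    exact (iInf₂_le (0 : EuclideanSpace ℝ (Fin d) → EuclideanSpace ℝ (Fin d)) h).trans
      (by simp)
  · have : gagliardoQuotient s p (0 : EuclideanSpace ℝ (Fin d) → ℝ) = 0 := by
      ext z
      simp [gagliardoQuotient]
    rw [this, eLpNorm_zero]

theorem sobolevSeminorm_add_le {Ω : Set (EuclideanSpace ℝ (Fin d))} {s p : ℝ} [Fact (1 < p)]
    {u v : EuclideanSpace ℝ (Fin d) → ℝ}
    (hu : MemLp u (ENNReal.ofReal p) (volume.restrict Ω))
    (hv : MemLp v (ENNReal.ofReal p) (volume.restrict Ω)) :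
    sobolevSeminorm Ω s p (u + v) ≤ sobolevSeminorm Ω s p u + sobolevSeminorm Ω s p v := by
  unfold sobolevSeminorm
  split_ifs with hs
  · simp only [ENNReal.iInf_add, ENNReal.add_iInf]
    refine le_iInf₂ fun k hk => le_iInf₂ fun g hg => ?_
    refine (iInf₂_le (g + k) ⟨hg.1.add hk.1, hg.2.add hu hv hg.1 hk.1 hk.2⟩).trans ?_
    exact eLpNorm_add_le hg.1.1 hk.1.1 Fact.out
  · have meas : ∀ {w : EuclideanSpace ℝ (Fin d) → ℝ},
        AEStronglyMeasurable w (volume.restrict Ω) →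
        AEStronglyMeasurable (gagliardoQuotient s p w)
          ((volume.restrict Ω).prod (volume.restrict Ω)) := by
      intro w hw
      have hden : Measurable fun z : EuclideanSpace ℝ (Fin d) × EuclideanSpace ℝ (Fin d) =>
          ‖z.1 - z.2‖ ^ ((d : ℝ) / p + s) :=
        ((measurable_fst.sub measurable_snd).norm).pow_const _
      exact ((hw.comp_fst.sub hw.comp_snd).aemeasurable.div
        hden.aemeasurable).aestronglyMeasurable
    have : gagliardoQuotient s p (u + v) = gagliardoQuotient s p u + gagliardoQuotient s p v := by
      ext z
      simp only [gagliardoQuotient, Pi.add_apply]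
      ring
    rw [this]
    exact eLpNorm_add_le (meas hu.1) (meas hv.1) Fact.out

theorem sobolevSeminorm_const_smul_le {Ω : Set (EuclideanSpace ℝ (Fin d))} {s p : ℝ}
    (c : ℝ) (u : EuclideanSpace ℝ (Fin d) → ℝ) :
    sobolevSeminorm Ω s p (c • u) ≤ ‖c‖ₑ * sobolevSeminorm Ω s p u := by
  rcases eq_or_ne c 0 with rfl | hc
  · simp [sobolevSeminorm_zero]
  unfold sobolevSeminorm
  split_ifs with hs
  · rw [ENNReal.mul_iInf_of_ne (by simpa using hc) enorm_ne_top]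
    refine le_iInf fun g => ?_
    rw [ENNReal.mul_iInf_of_ne (by simpa using hc) enorm_ne_top]
    refine le_iInf fun hg => ?_
    refine (iInf₂_le (c • g) ⟨hg.1.const_smul c, hg.2.const_smul c⟩).trans ?_
    exact (eLpNorm_const_smul c g _ _).le
  · have : gagliardoQuotient s p (c • u) = c • gagliardoQuotient s p u := by
      ext z
      simp only [gagliardoQuotient, Pi.smul_apply, smul_eq_mul]
      ring
    rw [this]
    exact (eLpNorm_const_smul c _ _ _).le

/-- The elements of `L^p(Ω)` with finite `W^{s,p}` seminorm, as a linear subspace of `L^p(Ω)`. -/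
def sobolevSubmodule (Ω : Set (EuclideanSpace ℝ (Fin d))) (s p : ℝ) [Fact (1 < p)] :
    Submodule ℝ (Lp ℝ (ENNReal.ofReal p) (volume.restrict Ω)) where
  carrier := {u | sobolevSeminorm Ω s p u < (⊤ : ℝ≥0∞)}
  zero_mem' := by
    have h : sobolevSeminorm Ω s p
        ((0 : Lp ℝ (ENNReal.ofReal p) (volume.restrict Ω)) : EuclideanSpace ℝ (Fin d) → ℝ) = 0 := by
      rw [sobolevSeminorm_congr (Lp.coeFn_zero _ _ _), sobolevSeminorm_zero]
    exact h.trans_lt (by simp)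
  add_mem' := by
    intro u v hu hv
    simp only [mem_ofPred_eq] at *
    rw [sobolevSeminorm_congr (Lp.coeFn_add u v)]
    exact (sobolevSeminorm_add_le (Lp.memLp u) (Lp.memLp v)).trans_lt
      (ENNReal.add_lt_top.2 ⟨hu, hv⟩)
  smul_mem' := by
    intro c u hu
    simp only [mem_ofPred_eq] at *
    rw [sobolevSeminorm_congr (Lp.coeFn_smul c u)]
    exact (sobolevSeminorm_const_smul_le c u).trans_lt (ENNReal.mul_lt_top enorm_lt_top hu)

/-- The Sobolev(-Slobodeckij) space `W^{s,p}(Ω)`. This is a type synonym: it carries the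
`W^{s,p}` norm defined below, not the norm of `L^p(Ω)`. -/
def SobolevSpace (Ω : Set (EuclideanSpace ℝ (Fin d))) (s p : ℝ) [Fact (1 < p)] : Type :=
  ↥(sobolevSubmodule Ω s p)

namespace SobolevSpace

variable {Ω : Set (EuclideanSpace ℝ (Fin d))} {s p : ℝ} [Fact (1 < p)]

instance : AddCommGroup (SobolevSpace Ω s p) :=
  inferInstanceAs (AddCommGroup ↥(sobolevSubmodule Ω s p))

instance : Module ℝ (SobolevSpace Ω s p) :=
  inferInstanceAs (Module ℝ ↥(sobolevSubmodule Ω s p))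

/-- The inclusion `W^{s,p}(Ω) → L^p(Ω)`. -/
def toLp : SobolevSpace Ω s p →ₗ[ℝ] Lp ℝ (ENNReal.ofReal p) (volume.restrict Ω) :=
  (sobolevSubmodule Ω s p).subtype

theorem seminorm_lt_top (u : SobolevSpace Ω s p) : sobolevSeminorm Ω s p (toLp u) < (⊤ : ℝ≥0∞) :=
  u.2

/-- The norm `(‖u‖_{L^p}^p + |u|_{W^{s,p}}^p)^(1/p)`. -/
instance : Norm (SobolevSpace Ω s p) :=
  ⟨fun u => (‖toLp u‖ ^ p + (sobolevSeminorm Ω s p (toLp u)).toReal ^ p) ^ (1 / p)⟩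

theorem norm_def (u : SobolevSpace Ω s p) :
    ‖u‖ = (‖toLp u‖ ^ p + (sobolevSeminorm Ω s p (toLp u)).toReal ^ p) ^ (1 / p) :=
  rfl

theorem seminorm_add_le (u v : SobolevSpace Ω s p) :
    (sobolevSeminorm Ω s p (toLp (u + v))).toReal ≤
      (sobolevSeminorm Ω s p (toLp u)).toReal + (sobolevSeminorm Ω s p (toLp v)).toReal := by
  rw [← ENNReal.toReal_add (seminorm_lt_top u).ne (seminorm_lt_top v).ne]
  refine ENNReal.toReal_mono
    (ENNReal.add_lt_top.2 ⟨seminorm_lt_top u, seminorm_lt_top v⟩).ne ?_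
  rw [map_add, sobolevSeminorm_congr (Lp.coeFn_add (toLp u) (toLp v))]
  exact sobolevSeminorm_add_le (Lp.memLp _) (Lp.memLp _)

theorem seminorm_smul_le (c : ℝ) (u : SobolevSpace Ω s p) :
    (sobolevSeminorm Ω s p (toLp (c • u))).toReal ≤
      |c| * (sobolevSeminorm Ω s p (toLp u)).toReal := by
  have h : sobolevSeminorm Ω s p (toLp (c • u)) ≤ ‖c‖ₑ * sobolevSeminorm Ω s p (toLp u) := by
    rw [map_smul, sobolevSeminorm_congr (Lp.coeFn_smul c (toLp u))]
    exact sobolevSeminorm_const_smul_le c _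
  have h2 := ENNReal.toReal_mono (ENNReal.mul_lt_top enorm_lt_top (seminorm_lt_top u)).ne h
  simpa [ENNReal.toReal_mul] using h2

theorem norm_add_le' (u v : SobolevSpace Ω s p) : ‖u + v‖ ≤ ‖u‖ + ‖v‖ := by
  have hp : 1 < p := Fact.out
  have hp0 : 0 ≤ p := by linarith
  have hip : 0 ≤ 1 / p := by positivity
  have h := Real.Lp_add_le_of_nonneg (Finset.univ : Finset (Fin 2)) hp.le
    (f := ![‖toLp u‖, (sobolevSeminorm Ω s p (toLp u)).toReal])
    (g := ![‖toLp v‖, (sobolevSeminorm Ω s p (toLp v)).toReal])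
    (by intro i _; fin_cases i <;> simp) (by intro i _; fin_cases i <;> simp)
  simp only [Fin.sum_univ_two, Matrix.cons_val_zero, Matrix.cons_val_one] at h
  simp only [norm_def]
  refine le_trans (Real.rpow_le_rpow (by positivity) ?_ hip) h
  refine add_le_add (Real.rpow_le_rpow (by positivity) ?_ hp0)
    (Real.rpow_le_rpow (by positivity) (seminorm_add_le u v) hp0)
  rw [map_add]
  exact norm_add_le _ _

theorem norm_smul_le' (c : ℝ) (u : SobolevSpace Ω s p) : ‖c • u‖ ≤ |c| * ‖u‖ := by
  have hp : 1 < p := Fact.out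
  have hp0 : 0 ≤ p := by linarith
  have hpne : p ≠ 0 := by linarith
  have hip : 0 ≤ 1 / p := by positivity
  simp only [norm_def]
  have hc : |c| = (|c| ^ p) ^ (1 / p) := by
    rw [← Real.rpow_mul (abs_nonneg c), mul_one_div_cancel hpne, Real.rpow_one]
  rw [hc, ← Real.mul_rpow (by positivity) (by positivity)]
  refine Real.rpow_le_rpow (by positivity) ?_ hip
  rw [mul_add, ← Real.mul_rpow (by positivity) (by positivity),
    ← Real.mul_rpow (by positivity) (by positivity)]
  refine add_le_add (Real.rpow_le_rpow (by positivity) ?_ hp0)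
    (Real.rpow_le_rpow (by positivity) (seminorm_smul_le c u) hp0)
  rw [map_smul, norm_smul, Real.norm_eq_abs]

theorem norm_zero' : ‖(0 : SobolevSpace Ω s p)‖ = 0 := by
  refine le_antisymm ?_ (by rw [norm_def]; positivity)
  simpa using norm_smul_le' 0 (0 : SobolevSpace Ω s p)

theorem eq_zero_of_norm (u : SobolevSpace Ω s p) (h : ‖u‖ = 0) : u = 0 := by
  have hp : 1 < p := Fact.out
  rw [norm_def, Real.rpow_eq_zero (by positivity) (by positivity)] at h
  have h1 : ‖toLp u‖ ^ p = 0 := by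
    have ha : 0 ≤ ‖toLp u‖ ^ p := by positivity
    have hb : 0 ≤ (sobolevSeminorm Ω s p (toLp u)).toReal ^ p := by positivity
    linarith
  rw [Real.rpow_eq_zero (norm_nonneg _) (by linarith), norm_eq_zero] at h1
  exact Subtype.ext h1

instance : NormedAddCommGroup (SobolevSpace Ω s p) :=
  AddGroupNorm.toNormedAddCommGroup
    { toFun := fun u => ‖u‖
      map_zero' := norm_zero'
      add_le' := norm_add_le'
      neg' := fun u => by
        refine le_antisymm ?_ ?_
        · simpa using norm_smul_le' (-1) u
        · simpa using norm_smul_le' (-1) (-u)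
      eq_zero_of_map_eq_zero' := eq_zero_of_norm }

instance : NormedSpace ℝ (SobolevSpace Ω s p) where
  norm_smul_le := norm_smul_le'

end SobolevSpace

/-- The set `{q ∈ L^∞(Ω) : -1 ≤ q ≤ 1 a.e.}` as a subset of the dual of `W^{s,p}(Ω)`:
the function `q` is identified with the functional `v ↦ ∫_Ω q v dx`. -/
def unitBoundsInDual (Ω : Set (EuclideanSpace ℝ (Fin d))) (s p : ℝ) [Fact (1 < p)] :
    Set (StrongDual ℝ (SobolevSpace Ω s p)) :=
  {ℓ | ∃ q : Lp ℝ ⊤ (volume.restrict Ω),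
    (∀ᵐ x ∂(volume.restrict Ω), -1 ≤ q x ∧ q x ≤ 1) ∧
      ∀ v : SobolevSpace Ω s p, ℓ v = ∫ x in Ω, q x * SobolevSpace.toLp v x}

end Sobolev

end

/-!
By Hahn–Banach and the duality `(L¹)* = L^∞`, `M` consists of the functionals `ℓ` with
`|ℓ v| ≤ ‖v‖_{L¹}` for all `v`, whence it is closed. A function `v ∈ W^{s,p}(Ω)` that is positive
almost everywhere attains its maximum over `M` only at `q = 1`. As a normal vector at `q = 1`, it
therefore annihilates no radial direction but `0`, and `M` fails to be polyhedric once there is a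
nonzero tangent direction at `q = 1` annihilated by `v`.

Such a direction is minus the evaluation `δ` at a point `x₀ ∈ Ω`, for `v = min (|x - x₀|, 1)`. To
see that `-δ` is tangent, let `ρ` be a smooth probability density on the unit ball and consider
`φ_c = c ^ d ρ (c (x₀ - ·))`. Each `-φ_c` is a radial direction, being bounded and nonpositive.
Morrey's argument on the ball of radius `1 / c` bounds the norm of `φ_{2c} - φ_c` in the dual of
`W^{s,p}(Ω)` by a multiple of `c ^ (d / p - s)`: for `s < 1` one pairs the two averages in a double
integral and applies Hölder to the Gagliardo quotient; for `s = 1` one uses that `d φ_c / d c` is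
`1 / c` times the divergence of the vector field `φ_c (x) (x - x₀)`. As `s > d / p`, the
functionals `φ_c` with `c = 2 ^ n` times a constant form a Cauchy sequence, with limit `δ`.
-/

section Cones

variable {W : Type*} [NormedAddCommGroup W] [NormedSpace ℝ W] {K : Set W} {w : W}
  {η : StrongDual ℝ W}

theorem radialCone_subset_of_forall_le (hη : ∀ k ∈ K, η k ≤ η w) :
    radialCone K w ⊆ {x | η x ≤ 0} := by
  rintro _ ⟨t, ht, k, hk, rfl⟩
  rw [mem_ofPred_eq, map_smul, map_sub, smul_eq_mul]
  exact mul_nonpos_of_nonneg_of_nonpos ht.le (sub_nonpos.2 (hη k hk))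

theorem mem_normalCone_of_forall_le (hη : ∀ k ∈ K, η k ≤ η w) : η ∈ normalCone K w :=
  closure_minimal (radialCone_subset_of_forall_le hη) (isClosed_le η.continuous continuous_const)

theorem radialCone_inter_annihilator_subset (hη : ∀ k ∈ K, η k = η w → k = w) :
    radialCone K w ∩ annihilator η ⊆ {0} := by
  rintro _ ⟨⟨t, ht, k, hk, rfl⟩, h⟩
  have hkw : η k = η w := by
    simpa only [annihilator, mem_ofPred_eq, map_smul, map_sub, smul_eq_zero, ht.ne', false_or,
      sub_eq_zero] using h
  rw [hη k hk hkw, sub_self, smul_zero, mem_singleton_iff]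

/-- At an exposed point, only the zero direction is both radial and critical. -/
theorem not_isPolyhedric_of_exposed (hw : w ∈ K) (hmax : ∀ k ∈ K, η k ≤ η w)
    (hexp : ∀ k ∈ K, η k = η w → k = w) {y : W} (hyT : y ∈ tangentCone K w) (hyη : η y = 0)
    (hy : y ≠ 0) : ¬ IsPolyhedric K := by
  intro h
  have hyR : y ∈ closure (radialCone K w ∩ annihilator η) :=
    (h w hw η (mem_normalCone_of_forall_le hmax)).subset ⟨hyT, hyη⟩
  exact hy (closure_minimal (radialCone_inter_annihilator_subset hexp) isClosed_singleton hyR)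

end Cones

section HahnBanach

variable {V F : Type*} [AddCommGroup V] [Module ℝ V] [NormedAddCommGroup F] [NormedSpace ℝ F]

theorem exists_dual_comp_eq_of_abs_le_norm {T : V →ₗ[ℝ] F} {ℓ : V →ₗ[ℝ] ℝ} {C : ℝ} (hC : 0 ≤ C)
    (hℓ : ∀ v, |ℓ v| ≤ C * ‖T v‖) :
    ∃ Λ : StrongDual ℝ F, ‖Λ‖ ≤ C ∧ ∀ v, Λ (T v) = ℓ v := by
  have hker : LinearMap.ker T ≤ LinearMap.ker ℓ := fun v hv => by
    simpa [LinearMap.mem_ker.1 hv] using hℓ v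
  let ℓT : LinearMap.range T →ₗ[ℝ] ℝ :=
    (LinearMap.ker T).liftQ ℓ hker ∘ₗ T.quotKerEquivRange.symm.toLinearMap
  have hℓT : ∀ v, ℓT (T.rangeRestrict v) = ℓ v := fun v => by
    have hv : T.rangeRestrict v = T.quotKerEquivRange (Submodule.Quotient.mk v) := rfl
    rw [hv, LinearMap.comp_apply, LinearEquiv.coe_coe, LinearEquiv.symm_apply_apply]
    exact Submodule.liftQ_apply _ _ _
  have hbound : ∀ y, ‖ℓT y‖ ≤ C * ‖y‖ := fun y => by
    obtain ⟨v, rfl⟩ := T.surjective_rangeRestrict y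
    rw [hℓT]
    exact hℓ v
  obtain ⟨Λ, hΛ, hnorm⟩ := exists_extension_norm_eq (LinearMap.range T)
    (ℓT.mkContinuous C hbound)
  exact ⟨Λ, hnorm.trans_le (LinearMap.mkContinuous_norm_le _ hC _),
    fun v => (hΛ (T.rangeRestrict v)).trans (hℓT v)⟩

end HahnBanach

section DualL1

variable {α : Type*} [MeasurableSpace α] {μ : Measure α}

theorem norm_le_iff_ae_norm_le {E : Type*} [NormedAddCommGroup E] {C : ℝ} (hC : 0 ≤ C)
    (f : Lp E ⊤ μ) : ‖f‖ ≤ C ↔ ∀ᵐ x ∂μ, ‖f x‖ ≤ C := by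
  refine ⟨fun h => ?_, fun h => ?_⟩
  · have hsup : eLpNormEssSup f μ ≤ ENNReal.ofReal C := by
      rw [← eLpNorm_exponent_top, ← Lp.enorm_def, ← ofReal_norm]
      exact ENNReal.ofReal_le_ofReal h
    filter_upwards [ae_le_eLpNormEssSup (f := f) (μ := μ)] with x hx
    rw [← ofReal_norm] at hx
    exact (ENNReal.ofReal_le_ofReal_iff hC).1 (hx.trans hsup)
  · rw [Lp.norm_def, eLpNorm_exponent_top]
    exact ENNReal.toReal_le_of_le_ofReal hC (eLpNormEssSup_le_of_ae_bound h)

theorem dual_Lp_ext {p : ℝ≥0∞} [Fact (1 ≤ p)] (hp : p ≠ ⊤) {Λ₁ Λ₂ : StrongDual ℝ (Lp ℝ p μ)}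
    (h : ∀ (A : Set α) (hA : MeasurableSet A) (hμA : μ A ≠ ⊤),
      Λ₁ (indicatorConstLp p hA hμA 1) = Λ₂ (indicatorConstLp p hA hμA 1)) : Λ₁ = Λ₂ := by
  refine ContinuousLinearMap.ext fun f => ?_
  induction f using Lp.induction hp with
  | @indicatorConst c A hA hμA =>
    have hc : indicatorConstLp p hA hμA.ne c = c • indicatorConstLp p hA hμA.ne (1 : ℝ) := by
      rw [indicatorConstLp, indicatorConstLp, ← MemLp.toLp_const_smul]
      refine MemLp.toLp_congr _ _ (Eventually.of_forall fun x => ?_)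
      rw [Pi.smul_apply, ← indicator_const_smul_apply, smul_eq_mul, mul_one]
    rw [Lp.simpleFunc.coe_indicatorConst, hc, map_smul, map_smul, h]
  | add hf hg _ hΛf hΛg => rw [map_add, map_add, hΛf, hΛg]
  | isClosed => exact isClosed_eq Λ₁.continuous Λ₂.continuous

theorem abs_lpPairing_le (q : Lp ℝ ⊤ μ) (f : Lp ℝ 1 μ) :
    |(ContinuousLinearMap.mul ℝ ℝ).lpPairing μ ⊤ 1 q f| ≤ ‖q‖ * ‖f‖ := by
  rw [ContinuousLinearMap.lpPairing_eq_integral, ← Real.norm_eq_abs, L1.norm_eq_integral_norm,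
    ← integral_const_mul]
  refine norm_integral_le_of_norm_le ((L1.integrable_coeFn f).norm.const_mul _) ?_
  filter_upwards [(norm_le_iff_ae_norm_le (norm_nonneg q) q).1 le_rfl] with x hx
  rw [ContinuousLinearMap.mul_apply', norm_mul]
  gcongr

variable [IsFiniteMeasure μ]

/-- The inclusion `L^q(μ) → L^p(μ)`, `p ≤ q`, for a finite measure `μ`. -/
noncomputable def lpInclusion (μ : Measure α) [IsFiniteMeasure μ] {p q : ℝ≥0∞} [Fact (1 ≤ p)]
    [Fact (1 ≤ q)] (hpq : p ≤ q) : Lp ℝ q μ →L[ℝ] Lp ℝ p μ :=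
  LinearMap.mkContinuous
    { toFun := fun f => ((Lp.memLp f).mono_exponent hpq).toLp f
      map_add' := fun f g => by
        rw [← MemLp.toLp_add]
        exact MemLp.toLp_congr _ _ (Lp.coeFn_add f g)
      map_smul' := fun c f => by
        rw [RingHom.id_apply, ← MemLp.toLp_const_smul]
        exact MemLp.toLp_congr _ _ (Lp.coeFn_smul c f) }
    (μ univ ^ (1 / p.toReal - 1 / q.toReal)).toReal fun f => by
      have hexp : 0 ≤ 1 / p.toReal - 1 / q.toReal := by
        have hp : p⁻¹ ≠ ⊤ := ENNReal.inv_ne_top.2 (one_pos.trans_le Fact.out).ne'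
        simpa using ENNReal.toReal_mono hp (ENNReal.inv_le_inv.2 hpq)
      have hfin : μ univ ^ (1 / p.toReal - 1 / q.toReal) ≠ ⊤ :=
        ENNReal.rpow_ne_top_of_nonneg hexp (measure_ne_top _ _)
      have hle := ENNReal.toReal_mono (ENNReal.mul_ne_top (Lp.eLpNorm_ne_top f) hfin)
        (eLpNorm_le_eLpNorm_mul_rpow_measure_univ hpq (Lp.aestronglyMeasurable f))
      rw [LinearMap.coe_mk, AddHom.coe_mk, Lp.norm_toLp, Lp.norm_def]
      rwa [ENNReal.toReal_mul, mul_comm] at hle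

theorem coeFn_lpInclusion {p q : ℝ≥0∞} [Fact (1 ≤ p)] [Fact (1 ≤ q)] (hpq : p ≤ q)
    (f : Lp ℝ q μ) : lpInclusion μ hpq f =ᵐ[μ] f :=
  ((Lp.memLp f).mono_exponent hpq).coeFn_toLp

theorem lpInclusion_indicatorConstLp {p q : ℝ≥0∞} [Fact (1 ≤ p)] [Fact (1 ≤ q)] (hpq : p ≤ q)
    {A : Set α} (hA : MeasurableSet A) (c : ℝ) :
    lpInclusion μ hpq (indicatorConstLp q hA (measure_ne_top μ A) c) =
      indicatorConstLp p hA (measure_ne_top μ A) c :=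
  Lp.ext <| (coeFn_lpInclusion hpq _).trans <|
    indicatorConstLp_coeFn.trans indicatorConstLp_coeFn.symm

/-- On a finite measure space `L² ⊆ L¹`, so that the Riesz representation in `L²` applies. -/
theorem exists_integrable_setIntegral_eq (Λ : StrongDual ℝ (Lp ℝ 1 μ)) :
    ∃ r : α → ℝ, Integrable r μ ∧ ∀ (A : Set α) (hA : MeasurableSet A),
      Λ (indicatorConstLp 1 hA (measure_ne_top μ A) 1) = ∫ x in A, r x ∂μ := by
  let r := (InnerProductSpace.toDual ℝ (Lp ℝ 2 μ)).symm (Λ.comp (lpInclusion μ one_le_two))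
  refine ⟨r, (Lp.memLp r).integrable one_le_two, fun A hA => ?_⟩
  rw [← L2.inner_indicatorConstLp_one (𝕜 := ℝ) hA (measure_ne_top μ A), real_inner_comm,
    InnerProductSpace.toDual_symm_apply, ContinuousLinearMap.comp_apply,
    lpInclusion_indicatorConstLp]

theorem ae_abs_le_of_forall_abs_setIntegral_le {f : α → ℝ} (hf : Integrable f μ) {C : ℝ}
    (h : ∀ A, MeasurableSet A → |∫ x in A, f x ∂μ| ≤ C * μ.real A) : ∀ᵐ x ∂μ, |f x| ≤ C := by
  have hconst : ∀ (c : ℝ) (A : Set α), ∫ _ in A, c ∂μ = c * μ.real A := fun c A => by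
    rw [setIntegral_const, smul_eq_mul, mul_comm]
  have hub : f ≤ᵐ[μ] fun _ => C :=
    ae_le_of_forall_setIntegral_le hf (integrable_const C) fun A hA _ => by
      rw [hconst]
      exact (abs_le.1 (h A hA)).2
  have hlb : (fun _ => -C) ≤ᵐ[μ] f :=
    ae_le_of_forall_setIntegral_le (integrable_const (-C)) hf fun A hA _ => by
      rw [hconst, neg_mul]
      exact (abs_le.1 (h A hA)).1
  filter_upwards [hub, hlb] with x hx hx' using abs_le.2 ⟨hx', hx⟩

theorem exists_lpPairing_eq (Λ : StrongDual ℝ (Lp ℝ 1 μ)) :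
    ∃ q : Lp ℝ ⊤ μ, ‖q‖ ≤ ‖Λ‖ ∧ (ContinuousLinearMap.mul ℝ ℝ).lpPairing μ ⊤ 1 q = Λ := by
  obtain ⟨r, hr, hΛ⟩ := exists_integrable_setIntegral_eq Λ
  have hbound : ∀ᵐ x ∂μ, ‖r x‖ ≤ ‖Λ‖ :=
    ae_abs_le_of_forall_abs_setIntegral_le hr fun A hA => by
      simpa [hΛ, norm_indicatorConstLp] using
        Λ.le_opNorm (indicatorConstLp 1 hA (measure_ne_top μ A) 1)
  have hr' : MemLp r ⊤ μ := memLp_top_of_bound hr.aestronglyMeasurable ‖Λ‖ hbound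
  refine ⟨hr'.toLp r, (norm_le_iff_ae_norm_le (norm_nonneg _) _).2 ?_,
    dual_Lp_ext ENNReal.one_ne_top fun A hA _ => ?_⟩
  · filter_upwards [hr'.coeFn_toLp, hbound] with x hx hle using hx ▸ hle
  · rw [ContinuousLinearMap.lpPairing_eq_integral, hΛ A hA, ← integral_indicator hA]
    refine integral_congr_ae ?_
    filter_upwards [hr'.coeFn_toLp, indicatorConstLp_coeFn (p := 1) (hs := hA)
      (hμs := measure_ne_top μ A) (c := (1 : ℝ))] with x hx hind
    rw [hx, hind, ContinuousLinearMap.mul_apply', ← indicator_mul_right]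
    simp only [mul_one]

end DualL1

namespace SobolevSpace

variable {d : ℕ} {Ω : Set (EuclideanSpace ℝ (Fin d))} {s p : ℝ} [hp : Fact (1 < p)]

theorem norm_toLp_le (u : SobolevSpace Ω s p) : ‖toLp u‖ ≤ ‖u‖ := by
  rw [norm_def, one_div, Real.le_rpow_inv_iff_of_pos (by positivity) (by positivity)
    (one_pos.trans hp.out)]
  exact le_add_of_nonneg_right (by positivity)

theorem toReal_seminorm_le_norm (u : SobolevSpace Ω s p) :
    (sobolevSeminorm Ω s p (toLp u)).toReal ≤ ‖u‖ := by
  rw [norm_def, one_div, Real.le_rpow_inv_iff_of_pos (by positivity) (by positivity)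
    (one_pos.trans hp.out)]
  exact le_add_of_nonneg_left (by positivity)

theorem memLp_toLp (u : SobolevSpace Ω s p) :
    MemLp (toLp u) (ENNReal.ofReal p) (volume.restrict Ω) :=
  Lp.memLp (toLp u)

theorem exists_toLp_ae_eq {f : EuclideanSpace ℝ (Fin d) → ℝ}
    (hf : MemLp f (ENNReal.ofReal p) (volume.restrict Ω)) (hfin : sobolevSeminorm Ω s p f < ⊤) :
    ∃ u : SobolevSpace Ω s p, toLp u =ᵐ[volume.restrict Ω] f :=
  ⟨⟨hf.toLp f, by
    change sobolevSeminorm Ω s p (hf.toLp f) < ⊤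
    rwa [sobolevSeminorm_congr hf.coeFn_toLp]⟩, hf.coeFn_toLp⟩

variable [IsFiniteMeasure (volume.restrict Ω)]

/-- The inclusion `W^{s,p}(Ω) → L¹(Ω)`, for `Ω` of finite volume. -/
noncomputable def toL1 : SobolevSpace Ω s p →L[ℝ] Lp ℝ 1 (volume.restrict Ω) :=
  (lpInclusion (volume.restrict Ω) (Fact.out : 1 ≤ ENNReal.ofReal p)).comp
    (LinearMap.mkContinuous toLp 1 fun u => by simpa only [one_mul] using norm_toLp_le u)

theorem coeFn_toL1 (u : SobolevSpace Ω s p) : toL1 u =ᵐ[volume.restrict Ω] toLp u :=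
  coeFn_lpInclusion Fact.out (toLp u)

theorem integrable_toLp (u : SobolevSpace Ω s p) : Integrable (toLp u) (volume.restrict Ω) :=
  (memLp_toLp u).integrable Fact.out

/-- The identification of `q ∈ L^∞(Ω)` with the functional `v ↦ ∫_Ω q v` on `W^{s,p}(Ω)`. -/
noncomputable def integralDual :
    Lp ℝ ⊤ (volume.restrict Ω) →L[ℝ] StrongDual ℝ (SobolevSpace Ω s p) :=
  (ContinuousLinearMap.precomp ℝ toL1).comp
    ((ContinuousLinearMap.mul ℝ ℝ).lpPairing (volume.restrict Ω) ⊤ 1)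

theorem integralDual_apply (q : Lp ℝ ⊤ (volume.restrict Ω)) (v : SobolevSpace Ω s p) :
    integralDual q v = ∫ x in Ω, q x * toLp v x := by
  refine (ContinuousLinearMap.lpPairing_eq_integral _ q (toL1 v)).trans (integral_congr_ae ?_)
  filter_upwards [coeFn_toL1 v] with x hx
  rw [hx, ContinuousLinearMap.mul_apply']

theorem unitBoundsInDual_eq_image_closedBall :
    unitBoundsInDual Ω s p = integralDual '' Metric.closedBall 0 1 := by
  ext ℓ
  simp only [unitBoundsInDual, mem_ofPred_eq, mem_image, mem_closedBall_zero_iff,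
    norm_le_iff_ae_norm_le zero_le_one, Real.norm_eq_abs, abs_le, ContinuousLinearMap.ext_iff,
    integralDual_apply, eq_comm]

theorem mem_unitBoundsInDual_iff {ℓ : StrongDual ℝ (SobolevSpace Ω s p)} :
    ℓ ∈ unitBoundsInDual Ω s p ↔ ∀ v, |ℓ v| ≤ ‖toL1 v‖ := by
  rw [unitBoundsInDual_eq_image_closedBall]
  constructor
  · rintro ⟨q, hq, rfl⟩ v
    exact (abs_lpPairing_le q (toL1 v)).trans <|
      mul_le_of_le_one_left (norm_nonneg _) (mem_closedBall_zero_iff.1 hq)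
  · intro hℓ
    obtain ⟨Λ, hΛ, hΛℓ⟩ := exists_dual_comp_eq_of_abs_le_norm (T := toL1.toLinearMap)
      (ℓ := ℓ.toLinearMap) zero_le_one fun v => (hℓ v).trans_eq (one_mul _).symm
    obtain ⟨q, hq, rfl⟩ := exists_lpPairing_eq Λ
    exact ⟨q, mem_closedBall_zero_iff.2 (hq.trans hΛ), ContinuousLinearMap.ext hΛℓ⟩

theorem isClosed_unitBoundsInDual : IsClosed (unitBoundsInDual Ω s p) := by
  have hM : unitBoundsInDual Ω s p = ⋂ v : SobolevSpace Ω s p, {ℓ | |ℓ v| ≤ ‖toL1 v‖} := by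
    ext ℓ
    rw [mem_unitBoundsInDual_iff, mem_iInter]
    rfl
  rw [hM]
  exact isClosed_iInter fun v =>
    isClosed_le (ContinuousLinearMap.apply ℝ ℝ v).continuous.abs continuous_const

theorem convex_unitBoundsInDual : Convex ℝ (unitBoundsInDual Ω s p) := by
  rw [unitBoundsInDual_eq_image_closedBall]
  exact (convex_closedBall 0 1).linear_image integralDual.toLinearMap

theorem integralDual_const_mem_unitBoundsInDual :
    integralDual (Lp.const ⊤ (volume.restrict Ω) 1) ∈ unitBoundsInDual Ω s p := by
  rw [unitBoundsInDual_eq_image_closedBall]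
  refine mem_image_of_mem _ (mem_closedBall_zero_iff.2 ?_)
  rw [norm_le_iff_ae_norm_le zero_le_one]
  filter_upwards [Lp.coeFn_const ⊤ (volume.restrict Ω) (1 : ℝ)] with x hx
  rw [hx, Function.const_apply, norm_one]

theorem neg_integralDual_mem_radialCone {φ : Lp ℝ ⊤ (volume.restrict Ω)}
    (hφ : 0 ≤ᵐ[volume.restrict Ω] φ) :
    -integralDual φ ∈
      radialCone (unitBoundsInDual Ω s p) (integralDual (Lp.const ⊤ (volume.restrict Ω) 1)) := by
  set t : ℝ := ‖φ‖ + 1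
  have ht : 0 < t := by positivity
  have hq : ‖Lp.const ⊤ (volume.restrict Ω) 1 - t⁻¹ • φ‖ ≤ 1 := by
    rw [norm_le_iff_ae_norm_le zero_le_one]
    filter_upwards [hφ, (norm_le_iff_ae_norm_le (norm_nonneg φ) φ).1 le_rfl,
      Lp.coeFn_sub (Lp.const ⊤ (volume.restrict Ω) (1 : ℝ)) (t⁻¹ • φ),
      Lp.coeFn_const ⊤ (volume.restrict Ω) (1 : ℝ), Lp.coeFn_smul t⁻¹ φ] with x h0 hle hsub h1 hsmul
    have hφt : t⁻¹ * φ x ≤ 1 := by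
      rw [inv_mul_le_one₀ ht]
      linarith [le_abs_self (φ x), Real.norm_eq_abs (φ x)]
    have hφ0 : 0 ≤ t⁻¹ * φ x := mul_nonneg (inv_nonneg.2 ht.le) h0
    rw [hsub, Pi.sub_apply, h1, hsmul, Pi.smul_apply, Function.const_apply, smul_eq_mul,
      Real.norm_eq_abs, abs_le]
    constructor <;> linarith
  refine ⟨t, ht, integralDual (Lp.const ⊤ (volume.restrict Ω) 1 - t⁻¹ • φ), ?_, ?_⟩
  · rw [unitBoundsInDual_eq_image_closedBall]
    exact mem_image_of_mem _ (mem_closedBall_zero_iff.2 hq)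
  · rw [map_sub, map_smul, sub_sub_cancel_left, smul_neg, smul_inv_smul₀ ht.ne']

theorem integralDual_const_apply (v : SobolevSpace Ω s p) :
    integralDual (Lp.const ⊤ (volume.restrict Ω) 1) v = ∫ x in Ω, toLp v x := by
  rw [integralDual_apply]
  refine integral_congr_ae ?_
  filter_upwards [Lp.coeFn_const ⊤ (volume.restrict Ω) (1 : ℝ)] with x hx
  rw [hx, Function.const_apply, one_mul]

variable {v : SobolevSpace Ω s p}

theorem apply_le_integral_of_mem_unitBoundsInDual (hv : 0 ≤ᵐ[volume.restrict Ω] toLp v)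
    {ℓ : StrongDual ℝ (SobolevSpace Ω s p)} (hℓ : ℓ ∈ unitBoundsInDual Ω s p) :
    ℓ v ≤ ∫ x in Ω, toLp v x := by
  refine (le_abs_self _).trans ((mem_unitBoundsInDual_iff.1 hℓ v).trans_eq ?_)
  rw [L1.norm_eq_integral_norm]
  refine integral_congr_ae ?_
  filter_upwards [coeFn_toL1 v, hv] with x hx h0
  rw [hx, Real.norm_of_nonneg h0]

theorem eq_integralDual_const_of_apply_eq_integral (hv : ∀ᵐ x ∂volume.restrict Ω, 0 < toLp v x)
    {ℓ : StrongDual ℝ (SobolevSpace Ω s p)} (hℓ : ℓ ∈ unitBoundsInDual Ω s p)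
    (h : ℓ v = ∫ x in Ω, toLp v x) :
    ℓ = integralDual (Lp.const ⊤ (volume.restrict Ω) 1) := by
  obtain ⟨q, hq, hqℓ⟩ := hℓ
  have hint : Integrable (fun x => q x * toLp v x) (volume.restrict Ω) :=
    (integrable_toLp v).bdd_mul (Lp.aestronglyMeasurable q) (c := 1)
      (hq.mono fun x hx => abs_le.2 hx)
  have hle : (fun x => q x * toLp v x) ≤ᵐ[volume.restrict Ω] toLp v := by
    filter_upwards [hq, hv] with x hx h0 using mul_le_of_le_one_left h0.le hx.2
  have heq := (integral_eq_iff_of_ae_le hint (integrable_toLp v) hle).1 ((hqℓ v).symm.trans h)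
  have hq1 : q = Lp.const ⊤ (volume.restrict Ω) 1 := by
    refine Lp.ext ?_
    filter_upwards [heq, hv, Lp.coeFn_const ⊤ (volume.restrict Ω) (1 : ℝ)] with x hx h0 h1
    rw [h1, Function.const_apply]
    exact (mul_eq_right₀ h0.ne').1 hx
  rw [← hq1]
  exact ContinuousLinearMap.ext fun u => (hqℓ u).trans (integralDual_apply q u).symm

end SobolevSpace

section Lipschitz

variable {d : ℕ} {Ω : Set (EuclideanSpace ℝ (Fin d))} {f : EuclideanSpace ℝ (Fin d) → ℝ}

theorem gradient_apply_eq_fderiv_single (x : EuclideanSpace ℝ (Fin d)) (i : Fin d) :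
    gradient f x i = fderiv ℝ f x (EuclideanSpace.single i 1) := by
  rw [← toDual_gradient, InnerProductSpace.toDual_apply_apply, EuclideanSpace.inner_single_right,
    one_mul, conj_trivial]

theorem isWeakGradient_gradient_of_lipschitzWith {C : NNReal} (hf : LipschitzWith C f) :
    IsWeakGradient Ω f (gradient f) := by
  intro φ hφ hc hΩ i
  have hφΩ : ∀ x ∉ Ω, φ x = 0 := fun x hx => image_eq_zero_of_notMem_tsupport fun h => hx (hΩ h)
  have hφΩ' : ∀ x ∉ Ω, fderiv ℝ φ x = 0 := fun x hx =>
    image_eq_zero_of_notMem_tsupport fun h => hx (hΩ (tsupport_fderiv_subset ℝ h))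
  obtain ⟨D, hD⟩ := hφ.lipschitzWith_of_hasCompactSupport hc (by simp)
  rw [setIntegral_eq_integral_of_forall_compl_eq_zero fun x hx => by simp [hφΩ' x hx],
    setIntegral_eq_integral_of_forall_compl_eq_zero fun x hx => by simp [hφΩ x hx],
    eq_neg_iff_add_eq_zero, add_comm, ← eq_neg_iff_add_eq_zero, ← integral_neg]
  calc ∫ x, gradient f x i * φ x
      = ∫ x, lineDeriv ℝ f x (EuclideanSpace.single i 1) * φ x := by
        refine integral_congr_ae ?_
        filter_upwards [hf.ae_differentiableAt] with x hx
        rw [gradient_apply_eq_fderiv_single, hx.lineDeriv_eq_fderiv]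
    _ = ∫ x, lineDeriv ℝ φ x (-EuclideanSpace.single i 1) * f x :=
        hf.integral_lineDeriv_mul_eq hD hc _
    _ = ∫ x, -(f x * fderiv ℝ φ x (EuclideanSpace.single i 1)) := by
        refine integral_congr_ae (Eventually.of_forall fun x => ?_)
        dsimp only
        rw [((hφ.differentiable (by simp)) x).lineDeriv_eq_fderiv, map_neg]
        ring

theorem memLp_gradient_of_lipschitzWith [IsFiniteMeasure (volume.restrict Ω)] {C : NNReal}
    (hf : LipschitzWith C f) (q : ℝ≥0∞) : MemLp (gradient f) q (volume.restrict Ω) := by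
  refine MemLp.of_bound ?_ C (Eventually.of_forall fun x => ?_)
  · exact ((InnerProductSpace.toDual ℝ _).symm.continuous.measurable.comp
      (measurable_fderiv ℝ f)).aestronglyMeasurable
  · rw [gradient, LinearIsometryEquiv.norm_map]
    exact norm_fderiv_le_of_lipschitz ℝ hf

theorem norm_gagliardoQuotient_rpow_le_of_lipschitzWith {s p : ℝ} (hp : 0 < p) {C : NNReal}
    (hf : LipschitzWith C f) (z : EuclideanSpace ℝ (Fin d) × EuclideanSpace ℝ (Fin d)) :
    ‖gagliardoQuotient s p f z‖ ^ p ≤ (C : ℝ) ^ p * ‖z.1 - z.2‖ ^ (-(d - p * (1 - s))) := by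
  rcases eq_or_ne z.1 z.2 with h | h
  · simp only [gagliardoQuotient, h, sub_self, zero_div, norm_zero, Real.zero_rpow hp.ne']
    positivity
  have hr : 0 < ‖z.1 - z.2‖ := norm_pos_iff.2 (sub_ne_zero.2 h)
  calc ‖gagliardoQuotient s p f z‖ ^ p
      = ‖f z.1 - f z.2‖ ^ p / ‖z.1 - z.2‖ ^ ((d / p + s) * p) := by
        rw [gagliardoQuotient, norm_div, Real.norm_of_nonneg (Real.rpow_nonneg hr.le _),
          Real.div_rpow (norm_nonneg _) (by positivity), ← Real.rpow_mul hr.le]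
    _ ≤ (C * ‖z.1 - z.2‖) ^ p / ‖z.1 - z.2‖ ^ ((d / p + s) * p) := by
        gcongr
        exact hf.norm_sub_le z.1 z.2
    _ = (C : ℝ) ^ p * ‖z.1 - z.2‖ ^ (-(d - p * (1 - s))) := by
        rw [Real.mul_rpow C.coe_nonneg hr.le, mul_div_assoc, ← Real.rpow_sub hr]
        congr 2
        field_simp
        ring

theorem norm_gagliardoQuotient_le_of_one_le_norm {s p M : ℝ} (hs : 0 ≤ s) (hp : 0 < p)
    (hM : ∀ x, ‖f x‖ ≤ M) {z : EuclideanSpace ℝ (Fin d) × EuclideanSpace ℝ (Fin d)}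
    (hz : 1 ≤ ‖z.1 - z.2‖) : ‖gagliardoQuotient s p f z‖ ≤ 2 * M := by
  rw [gagliardoQuotient, norm_div, Real.norm_of_nonneg (Real.rpow_nonneg (norm_nonneg _) _)]
  refine (div_le_self (norm_nonneg _) (Real.one_le_rpow hz (by positivity))).trans ?_
  linarith [norm_sub_le (f z.1) (f z.2), hM z.1, hM z.2]

theorem lintegral_prod_restrict_sub_le {G : Type*} [AddGroup G] [MeasurableSpace G]
    [MeasurableAdd G] [MeasurableNeg G] [MeasurableSub₂ G] {μ : Measure G} [SFinite μ]
    [μ.IsAddLeftInvariant] [μ.IsNegInvariant] {F : G → ℝ≥0∞} (hF : Measurable F) (S : Set G) :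
    ∫⁻ z, F (z.1 - z.2) ∂((μ.restrict S).prod (μ.restrict S)) ≤ (∫⁻ x, F x ∂μ) * μ S := by
  rw [lintegral_prod _ (by fun_prop), ← setLIntegral_const]
  refine lintegral_mono fun x => (setLIntegral_le_lintegral _ _).trans_eq ?_
  exact lintegral_sub_left_eq_self F x

theorem eLpNorm_gagliardoQuotient_lt_top [IsFiniteMeasure (volume.restrict Ω)] (hd : 0 < d)
    {s p : ℝ} (hs0 : 0 ≤ s) (hs1 : s < 1) (hp : 0 < p) {C : NNReal} (hf : LipschitzWith C f)
    {M : ℝ} (hM : ∀ x, ‖f x‖ ≤ M) :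
    eLpNorm (gagliardoQuotient s p f) (ENNReal.ofReal p)
      ((volume.restrict Ω).prod (volume.restrict Ω)) < ⊤ := by
  set H : EuclideanSpace ℝ (Fin d) → ℝ := fun z => (C : ℝ) ^ p * ‖z‖ ^ (-(d - p * (1 - s)))
  set F : EuclideanSpace ℝ (Fin d) → ℝ≥0∞ := (Metric.ball 0 1).indicator fun z => ‖H z‖ₑ with hF
  have hHm : Measurable H := (measurable_norm.pow_const _).const_mul _
  have hFm : Measurable F := hHm.enorm.indicator measurableSet_ball
  have hFint : ∫⁻ z, F z < ⊤ := by
    have hα : (d : ℝ) - p * (1 - s) < d := sub_lt_self _ (mul_pos hp (sub_pos.2 hs1))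
    rw [lintegral_indicator measurableSet_ball]
    refine (integrableOn_ball_of_norm_le_rpow (C := (C : ℝ) ^ p) (α := d - p * (1 - s))
      (by rw [finrank_euclideanSpace_fin]; exact hd)
      (by rw [finrank_euclideanSpace_fin]; exact hα) (Eventually.of_forall fun z => ?_)
      hHm.aestronglyMeasurable).2
    exact (Real.norm_of_nonneg (by positivity)).le
  have hle : ∀ z, ‖gagliardoQuotient s p f z‖ₑ ^ p ≤
      F (z.1 - z.2) + ENNReal.ofReal ((2 * M) ^ p) := fun z => by
    rw [← ofReal_norm, ENNReal.ofReal_rpow_of_nonneg (norm_nonneg _) hp.le]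
    rcases lt_or_ge ‖z.1 - z.2‖ 1 with hz | hz
    · rw [hF, indicator_of_mem (mem_ball_zero_iff.2 hz), Real.enorm_of_nonneg (by positivity)]
      exact le_add_right (ENNReal.ofReal_le_ofReal
        (norm_gagliardoQuotient_rpow_le_of_lipschitzWith hp hf z))
    · refine le_add_left (ENNReal.ofReal_le_ofReal ?_)
      gcongr
      exact norm_gagliardoQuotient_le_of_one_le_norm hs0 hp hM hz
  rw [eLpNorm_lt_top_iff_lintegral_rpow_enorm_lt_top (by simpa using hp) ENNReal.ofReal_ne_top,
    ENNReal.toReal_ofReal hp.le]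
  refine (lintegral_mono hle).trans_lt ?_
  rw [lintegral_add_right _ measurable_const, lintegral_const]
  refine ENNReal.add_lt_top.2 ⟨(lintegral_prod_restrict_sub_le hFm Ω).trans_lt ?_,
    ENNReal.mul_lt_top ENNReal.ofReal_lt_top (measure_lt_top _ _)⟩
  exact ENNReal.mul_lt_top hFint (isFiniteMeasure_restrict.1 inferInstance).lt_top

theorem sobolevSeminorm_lt_top_of_lipschitzWith [IsFiniteMeasure (volume.restrict Ω)]
    (hd : 0 < d) {s p : ℝ} (hs0 : 0 ≤ s) (hs1 : s ≤ 1) (hp : 0 < p) {C : NNReal}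
    (hf : LipschitzWith C f) {M : ℝ} (hM : ∀ x, ‖f x‖ ≤ M) : sobolevSeminorm Ω s p f < ⊤ := by
  unfold sobolevSeminorm
  split_ifs with hs
  · have hmem := memLp_gradient_of_lipschitzWith (Ω := Ω) hf (ENNReal.ofReal p)
    exact (iInf₂_le _ ⟨hmem, isWeakGradient_gradient_of_lipschitzWith hf⟩).trans_lt hmem.2
  · exact eLpNorm_gagliardoQuotient_lt_top hd hs0 (lt_of_le_of_ne hs1 hs) hp hf hM

theorem exists_toLp_ae_eq_of_lipschitzWith [IsFiniteMeasure (volume.restrict Ω)]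
    (hd : 0 < d) {s p : ℝ} [hp : Fact (1 < p)] (hs0 : 0 ≤ s) (hs1 : s ≤ 1) {C : NNReal}
    (hf : LipschitzWith C f) {M : ℝ} (hM : ∀ x, ‖f x‖ ≤ M) :
    ∃ u : SobolevSpace Ω s p, SobolevSpace.toLp u =ᵐ[volume.restrict Ω] f :=
  SobolevSpace.exists_toLp_ae_eq
    (MemLp.of_bound hf.continuous.aestronglyMeasurable M (Eventually.of_forall hM))
    (sobolevSeminorm_lt_top_of_lipschitzWith hd hs0 hs1 (one_pos.trans hp.out) hf hM)

end Lipschitz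

section Dilation

open Module

variable {E : Type*} [NormedAddCommGroup E] [NormedSpace ℝ E]

/-- The mass-preserving dilation `x ↦ cⁿ ρ (c (x₀ - x))` of `ρ`, which concentrates at `x₀` as
`c → ∞`. -/
noncomputable def dilationKernel (ρ : E → ℝ) (x₀ : E) (c : ℝ) (x : E) : ℝ :=
  c ^ finrank ℝ E * ρ (c • (x₀ - x))

/-- The divergence `n ρ + ∇ρ · z` of the vector field `z ↦ ρ z • z`. -/
noncomputable def radialDivergence (ρ : E → ℝ) (z : E) : ℝ :=
  finrank ℝ E * ρ z + fderiv ℝ ρ z z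

variable {ρ : E → ℝ} {x₀ : E} {c : ℝ}

theorem support_dilationKernel_subset (hρ : Function.support ρ ⊆ Metric.closedBall 0 1)
    (hc : 0 < c) : Function.support (dilationKernel ρ x₀ c) ⊆ Metric.closedBall x₀ c⁻¹ := by
  intro x hx
  have hmem : ‖c • (x₀ - x)‖ ≤ 1 := mem_closedBall_zero_iff.1 (hρ (right_ne_zero_of_mul hx))
  rw [norm_smul, Real.norm_of_nonneg hc.le] at hmem
  rw [mem_closedBall_iff_norm', inv_eq_one_div, le_div_iff₀ hc, mul_comm]
  exact hmem

theorem setIntegral_dilationKernel_mul [MeasurableSpace E] {μ : Measure E} {S : Set E}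
    (hρ : Function.support ρ ⊆ Metric.closedBall 0 1) (hc : 0 < c)
    (hS : Metric.closedBall x₀ c⁻¹ ⊆ S) (f : E → ℝ) :
    ∫ x in S, dilationKernel ρ x₀ c x * f x ∂μ = ∫ x, dilationKernel ρ x₀ c x * f x ∂μ :=
  setIntegral_eq_integral_of_forall_compl_eq_zero fun _ hx =>
    mul_eq_zero_of_left (Function.notMem_support.1 fun h =>
      hx (hS (support_dilationKernel_subset hρ hc h))) _

theorem abs_dilationKernel_le {B : ℝ} (hB : ∀ z, |ρ z| ≤ B) (hc : 0 ≤ c) (x : E) :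
    |dilationKernel ρ x₀ c x| ≤ c ^ finrank ℝ E * B := by
  rw [dilationKernel, abs_mul, abs_of_nonneg (by positivity)]
  gcongr
  exact hB _

theorem continuous_dilationKernel (hρ : Continuous ρ) : Continuous (dilationKernel ρ x₀ c) := by
  unfold dilationKernel
  fun_prop

theorem contDiff_dilationKernel {n : ℕ∞} (hρ : ContDiff ℝ n ρ) :
    ContDiff ℝ n (dilationKernel ρ x₀ c) := by
  unfold dilationKernel
  fun_prop

theorem continuous_radialDivergence (hρ : ContDiff ℝ 1 ρ) : Continuous (radialDivergence ρ) :=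
  (hρ.continuous.const_mul _).add ((hρ.continuous_fderiv one_ne_zero).clm_apply continuous_id)

theorem support_radialDivergence_subset (ρ : E → ℝ) :
    Function.support (radialDivergence ρ) ⊆ tsupport ρ := by
  refine Function.support_subset_iff'.2 fun z hz => ?_
  have hfderiv : fderiv ℝ ρ z = 0 :=
    image_eq_zero_of_notMem_tsupport fun h => hz (tsupport_fderiv_subset ℝ h)
  rw [radialDivergence, image_eq_zero_of_notMem_tsupport hz, hfderiv, mul_zero,
    zero_apply, add_zero]

theorem hasDerivAt_dilationKernel (hρ : Differentiable ℝ ρ) (hc : c ≠ 0) (x : E) :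
    HasDerivAt (fun t => dilationKernel ρ x₀ t x)
      (c⁻¹ * dilationKernel (radialDivergence ρ) x₀ c x) c := by
  have hinner : HasDerivAt (fun t : ℝ => ρ (t • (x₀ - x)))
      (fderiv ℝ ρ (c • (x₀ - x)) (x₀ - x)) c := by
    have hsmul : HasDerivAt (fun t : ℝ => t • (x₀ - x)) (x₀ - x) c := by
      simpa only [one_smul] using (hasDerivAt_id' c).smul_const (x₀ - x)
    exact (hρ (c • (x₀ - x))).hasFDerivAt.comp_hasDerivAt c hsmul
  refine ((hasDerivAt_pow (finrank ℝ E) c).mul hinner).congr_deriv ?_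
  have hpow : (finrank ℝ E : ℝ) * c ^ (finrank ℝ E - 1) = finrank ℝ E * c ^ finrank ℝ E / c := by
    rcases Nat.eq_zero_or_pos (finrank ℝ E) with h | h
    · simp [h]
    · rw [mul_div_assoc, ← pow_sub_one_mul h.ne', mul_div_cancel_right₀ _ hc]
  rw [hpow, dilationKernel, radialDivergence, map_smul, smul_eq_mul]
  field_simp

/-- Computes the divergence of the vector field `dilationKernel ρ x₀ c x • (x - x₀)`. -/
theorem finrank_mul_dilationKernel_add_fderiv (hρ : Differentiable ℝ ρ) (x : E) :
    finrank ℝ E * dilationKernel ρ x₀ c x + fderiv ℝ (dilationKernel ρ x₀ c) x (x - x₀) =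
      dilationKernel (radialDivergence ρ) x₀ c x := by
  have hinner : HasFDerivAt (fun y => c • (x₀ - y)) (-(c • ContinuousLinearMap.id ℝ E)) x := by
    simpa using ((hasFDerivAt_id (𝕜 := ℝ) x).const_sub x₀).fun_const_smul c
  have hderiv : HasFDerivAt (dilationKernel ρ x₀ c) _ x :=
    ((hρ (c • (x₀ - x))).hasFDerivAt.comp x hinner).const_mul (c ^ finrank ℝ E)
  rw [hderiv.fderiv]
  simp only [dilationKernel, radialDivergence, ContinuousLinearMap.comp_neg,
    ContinuousLinearMap.comp_smulₛₗ, Real.ringHom_apply, ContinuousLinearMap.comp_id, smul_neg,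
    smul_sub, neg_apply, smul_apply, map_sub, map_smul, smul_eq_mul]
  ring

end Dilation

section DilationIntegral

open Module

variable {E : Type*} [NormedAddCommGroup E] [NormedSpace ℝ E] [FiniteDimensional ℝ E]
  [MeasurableSpace E] [BorelSpace E] {μ : Measure E} [μ.IsAddHaarMeasure]
  {ρ : E → ℝ} {x₀ : E} {c : ℝ} {S : Set E}

theorem integral_dilationKernel (hc : 0 < c) :
    ∫ x, dilationKernel ρ x₀ c x ∂μ = ∫ x, ρ x ∂μ := by
  simp only [dilationKernel]
  rw [integral_const_mul, integral_sub_left_eq_self (fun x => ρ (c • x)) μ x₀,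
    Measure.integral_comp_smul_of_nonneg μ ρ c (hR := hc.le), smul_eq_mul, mul_inv_cancel_left₀]
  positivity

theorem setIntegral_dilationKernel (hρ : Function.support ρ ⊆ Metric.closedBall 0 1) (hc : 0 < c)
    (hS : Metric.closedBall x₀ c⁻¹ ⊆ S) :
    ∫ x in S, dilationKernel ρ x₀ c x ∂μ = ∫ x, ρ x ∂μ := by
  rw [setIntegral_eq_integral_of_forall_compl_eq_zero, integral_dilationKernel hc]
  exact fun x hx => Function.notMem_support.1 fun h =>
    hx (hS (support_dilationKernel_subset hρ hc h))

theorem tendsto_setIntegral_dilationKernel_mul (hS : S ∈ 𝓝 x₀) (hSm : MeasurableSet S)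
    (hρ0 : ∀ z, 0 ≤ ρ z) (hρ1 : ∫ z, ρ z ∂μ = 1) (hρ : HasCompactSupport ρ) {f : E → ℝ}
    (hf : IntegrableOn f S μ) (hfc : ContinuousAt f x₀) :
    Tendsto (fun c => ∫ x in S, dilationKernel ρ x₀ c x * f x ∂μ) atTop (𝓝 (f x₀)) := by
  have hS_eq : S.indicator f =ᶠ[𝓝 x₀] f := by
    filter_upwards [hS] with x hx using indicator_of_mem hx f
  have hdecay : Tendsto (fun z => ‖z‖ ^ finrank ℝ E * ρ z) (Bornology.cobounded E) (𝓝 0) := by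
    rw [Metric.cobounded_eq_cocompact]
    exact (hρ.mul_left (f := fun z => ‖z‖ ^ finrank ℝ E)).is_zero_at_infty
  have h := tendsto_integral_comp_smul_smul_of_integrable' hρ0 hρ1 hdecay
    (hf.integrable_indicator hSm) (hfc.congr hS_eq.symm)
  rw [hS_eq.eq_of_nhds] at h
  refine h.congr fun c => ?_
  rw [← integral_indicator hSm]
  refine integral_congr_ae (Eventually.of_forall fun x => ?_)
  simp only [dilationKernel, smul_eq_mul, indicator_mul_right]

end DilationIntegral

section DilationDerivative

open Module

variable {E : Type*} [NormedAddCommGroup E] [NormedSpace ℝ E] [MeasurableSpace E]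
  [OpensMeasurableSpace E] {μ : Measure E} {ρ u : E → ℝ} {x₀ : E} {c : ℝ}

theorem hasDerivAt_integral_dilationKernel_mul (hρ : ContDiff ℝ 1 ρ) (hcpt : HasCompactSupport ρ)
    (hu : Integrable u μ) (hc : 0 < c) :
    HasDerivAt (fun t => ∫ x, dilationKernel ρ x₀ t x * u x ∂μ)
      (c⁻¹ * ∫ x, dilationKernel (radialDivergence ρ) x₀ c x * u x ∂μ) c := by
  have hdiv := continuous_radialDivergence hρ
  obtain ⟨B, hB⟩ := hcpt.exists_bound_of_continuous hρ.continuous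
  obtain ⟨B', hB'⟩ :=
    (hcpt.mono' (support_radialDivergence_subset ρ)).exists_bound_of_continuous hdiv
  have hderiv_le : ∀ x, ∀ t ∈ Ioo (c / 2) (2 * c),
      ‖t⁻¹ * dilationKernel (radialDivergence ρ) x₀ t x * u x‖ ≤
        (c / 2)⁻¹ * ((2 * c) ^ finrank ℝ E * B') * ‖u x‖ := fun x t ht => by
    have ht0 : 0 < t := (half_pos hc).trans ht.1
    have hB'0 : 0 ≤ B' := (norm_nonneg _).trans (hB' x₀)
    rw [norm_mul, norm_mul, norm_inv, Real.norm_of_nonneg ht0.le]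
    gcongr
    · exact ht.1.le
    · refine (abs_dilationKernel_le hB' ht0.le x).trans ?_
      gcongr
      exact ht.2.le
  have h := (hasDerivAt_integral_of_dominated_loc_of_deriv_le (μ := μ)
    (F := fun t x => dilationKernel ρ x₀ t x * u x)
    (F' := fun t x => t⁻¹ * dilationKernel (radialDivergence ρ) x₀ t x * u x)
    (Ioo_mem_nhds (half_lt_self hc) (by linarith))
    (Eventually.of_forall fun t =>
      (continuous_dilationKernel hρ.continuous).aestronglyMeasurable.mul hu.1)
    (hu.bdd_mul (continuous_dilationKernel hρ.continuous).aestronglyMeasurable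
      (Eventually.of_forall (abs_dilationKernel_le hB hc.le)))
    (((continuous_dilationKernel hdiv).aestronglyMeasurable.const_mul _).mul hu.1)
    (Eventually.of_forall hderiv_le) (hu.norm.const_mul _)
    (Eventually.of_forall fun x t ht => (hasDerivAt_dilationKernel
      (hρ.differentiable one_ne_zero) ((half_pos hc).trans ht.1).ne' x).mul_const (u x))).2
  simpa only [mul_assoc, integral_const_mul] using h

end DilationDerivative

section WeakGradient

variable {d : ℕ} {Ω : Set (EuclideanSpace ℝ (Fin d))}

theorem sum_fderiv_mul_sub_apply_single {φ : EuclideanSpace ℝ (Fin d) → ℝ}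
    (hφ : Differentiable ℝ φ) (x₀ x : EuclideanSpace ℝ (Fin d)) :
    ∑ i, fderiv ℝ (fun y => φ y * (y - x₀) i) x (EuclideanSpace.single i 1) =
      d * φ x + fderiv ℝ φ x (x - x₀) := by
  have hcoord : ∀ i, HasFDerivAt (fun y : EuclideanSpace ℝ (Fin d) => (y - x₀) i)
      (EuclideanSpace.proj (𝕜 := ℝ) i) x := fun i =>
    (EuclideanSpace.proj (𝕜 := ℝ) i).hasFDerivAt.sub_const (x₀ i)
  have hsum : x - x₀ = ∑ i, (x - x₀) i • EuclideanSpace.single i (1 : ℝ) := by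
    simpa only [EuclideanSpace.basisFun_apply, EuclideanSpace.basisFun_repr] using
      ((EuclideanSpace.basisFun (Fin d) ℝ).sum_repr (x - x₀)).symm
  have hterm : ∀ i, fderiv ℝ (fun y => φ y * (y - x₀) i) x (EuclideanSpace.single i 1) =
      φ x + (x - x₀) i * fderiv ℝ φ x (EuclideanSpace.single i 1) := fun i => by
    rw [((hφ x).hasFDerivAt.fun_mul (hcoord i)).fderiv]
    simp
  conv_rhs => rw [hsum, map_sum]
  simp only [hterm, Finset.sum_add_distrib, Finset.sum_const, Finset.card_univ, Fintype.card_fin,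
    nsmul_eq_mul, map_smul, smul_eq_mul]

/-- Tests the weak gradient against the vector field `φ x • (x - x₀)`. -/
theorem IsWeakGradient.integral_mul_radial {u φ : EuclideanSpace ℝ (Fin d) → ℝ}
    {g : EuclideanSpace ℝ (Fin d) → EuclideanSpace ℝ (Fin d)} (h : IsWeakGradient Ω u g)
    (hu : IntegrableOn u Ω) (hg : IntegrableOn g Ω) (hφ : ContDiff ℝ ∞ φ)
    (hcpt : HasCompactSupport φ) (hφΩ : tsupport φ ⊆ Ω) (x₀ : EuclideanSpace ℝ (Fin d)) :
    ∫ x in Ω, u x * (d * φ x + fderiv ℝ φ x (x - x₀)) =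
      -∫ x in Ω, φ x * inner ℝ (g x) (x - x₀) := by
  set ψ : Fin d → EuclideanSpace ℝ (Fin d) → ℝ := fun i y => φ y * (y - x₀) i with hψ
  have hψ_smooth : ∀ i, ContDiff ℝ ∞ (ψ i) := fun i => by
    have : ContDiff ℝ ∞ fun y : EuclideanSpace ℝ (Fin d) => (y - x₀) i :=
      (EuclideanSpace.proj (𝕜 := ℝ) i).contDiff.comp (contDiff_id.sub contDiff_const)
    exact hφ.mul this
  have hψ_cpt : ∀ i, HasCompactSupport (ψ i) := fun i => hcpt.mul_right
  have hψ_tsupport : ∀ i, tsupport (ψ i) ⊆ Ω := fun i => (tsupport_mul_subset_left).trans hφΩ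
  have hleft : ∀ i, Integrable (fun x => u x * fderiv ℝ (ψ i) x (EuclideanSpace.single i 1))
      (volume.restrict Ω) := fun i =>
    hu.locallyIntegrable.integrable_smul_right_of_hasCompactSupport
      (((hψ_smooth i).continuous_fderiv (by simp)).clm_apply continuous_const)
      ((hψ_cpt i).fderiv_apply (𝕜 := ℝ) _)
  have hright : ∀ i, Integrable (fun x => g x i * ψ i x) (volume.restrict Ω) := fun i =>
    ((EuclideanSpace.proj (𝕜 := ℝ) i).integrable_comp
      hg).locallyIntegrable.integrable_smul_right_of_hasCompactSupport
      (hψ_smooth i).continuous (hψ_cpt i)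
  calc ∫ x in Ω, u x * (d * φ x + fderiv ℝ φ x (x - x₀))
      = ∑ i, ∫ x in Ω, u x * fderiv ℝ (ψ i) x (EuclideanSpace.single i 1) := by
        rw [← integral_finsetSum _ fun i _ => hleft i]
        simp only [← Finset.mul_sum, hψ,
          sum_fderiv_mul_sub_apply_single (hφ.differentiable (by simp))]
    _ = -∑ i, ∫ x in Ω, g x i * ψ i x := by
        rw [← Finset.sum_neg_distrib]
        exact Finset.sum_congr rfl fun i _ => h (ψ i) (hψ_smooth i) (hψ_cpt i) (hψ_tsupport i) i
    _ = -∫ x in Ω, φ x * inner ℝ (g x) (x - x₀) := by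
        rw [← integral_finsetSum _ fun i _ => hright i]
        congr! 3 with x
        simp only [hψ, PiLp.inner_apply, Finset.mul_sum, RCLike.inner_apply, conj_trivial]
        exact Finset.sum_congr rfl fun i _ => by ring

variable {ρ : EuclideanSpace ℝ (Fin d) → ℝ} {x₀ : EuclideanSpace ℝ (Fin d)} {c B : ℝ}

theorem IsWeakGradient.abs_setIntegral_dilationKernel_radialDivergence_mul_le
    {u : EuclideanSpace ℝ (Fin d) → ℝ}
    {g : EuclideanSpace ℝ (Fin d) → EuclideanSpace ℝ (Fin d)} (h : IsWeakGradient Ω u g)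
    (hu : IntegrableOn u Ω) (hg : IntegrableOn g Ω) (hρ : ContDiff ℝ ∞ ρ)
    (hρs : Function.support ρ ⊆ Metric.closedBall 0 1) (hB : ∀ z, |ρ z| ≤ B) (hc : 0 < c)
    (hball : Metric.closedBall x₀ c⁻¹ ⊆ Ω) :
    |∫ x in Ω, dilationKernel (radialDivergence ρ) x₀ c x * u x| ≤
      c ^ d * B * c⁻¹ * ∫ x in Metric.closedBall x₀ c⁻¹, ‖g x‖ := by
  have hsupp : Function.support (dilationKernel ρ x₀ c) ⊆ Metric.closedBall x₀ c⁻¹ :=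
    support_dilationKernel_subset hρs hc
  have htsupp : tsupport (dilationKernel ρ x₀ c) ⊆ Metric.closedBall x₀ c⁻¹ :=
    closure_minimal hsupp Metric.isClosed_closedBall
  have hparts := h.integral_mul_radial hu hg (contDiff_dilationKernel hρ)
    (HasCompactSupport.of_support_subset_isCompact (isCompact_closedBall _ _) hsupp)
    (htsupp.trans hball) x₀
  have hdiv := finrank_mul_dilationKernel_add_fderiv (x₀ := x₀) (c := c)
    (hρ.differentiable (by simp))
  rw [finrank_euclideanSpace_fin] at hdiv
  simp only [hdiv, mul_comm (u _)] at hparts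
  have hvanish : ∀ x ∉ Metric.closedBall x₀ c⁻¹,
      dilationKernel ρ x₀ c x * inner ℝ (g x) (x - x₀) = 0 := fun x hx => by
    have hK : dilationKernel ρ x₀ c x = 0 := Function.notMem_support.1 fun h => hx (hsupp h)
    rw [hK, zero_mul]
  rw [hparts, abs_neg, setIntegral_eq_integral_of_forall_compl_eq_zero fun x hx =>
    hvanish x fun h => hx (hball h), ← setIntegral_eq_integral_of_forall_compl_eq_zero hvanish,
    ← integral_const_mul, ← Real.norm_eq_abs]
  refine norm_integral_le_of_norm_le ((hg.mono_set hball).norm.const_mul _) ?_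
  filter_upwards [ae_restrict_mem measurableSet_closedBall] with x hx
  have hK := abs_dilationKernel_le (x₀ := x₀) hB hc.le x
  rw [finrank_euclideanSpace_fin] at hK
  calc ‖dilationKernel ρ x₀ c x * inner ℝ (g x) (x - x₀)‖
      ≤ c ^ d * B * (‖g x‖ * c⁻¹) := by
        rw [norm_mul]
        refine mul_le_mul hK ((norm_inner_le_norm _ _).trans ?_) (norm_nonneg _)
          ((abs_nonneg _).trans hK)
        gcongr
        exact mem_closedBall_iff_norm.1 hx
    _ = c ^ d * B * c⁻¹ * ‖g x‖ := by ring

theorem IsWeakGradient.abs_setIntegral_dilationKernel_mul_sub_le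
    {u : EuclideanSpace ℝ (Fin d) → ℝ}
    {g : EuclideanSpace ℝ (Fin d) → EuclideanSpace ℝ (Fin d)} (h : IsWeakGradient Ω u g)
    (hu : IntegrableOn u Ω) (hg : IntegrableOn g Ω) (hρ : ContDiff ℝ ∞ ρ)
    (hρs : Function.support ρ ⊆ Metric.closedBall 0 1) (hB : ∀ z, |ρ z| ≤ B) (hc : 0 < c)
    (hball : Metric.closedBall x₀ c⁻¹ ⊆ Ω) :
    |(∫ x in Ω, dilationKernel ρ x₀ (2 * c) x * u x) - ∫ x in Ω, dilationKernel ρ x₀ c x * u x| ≤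
      (2 * c) ^ d * B * c⁻¹ * ∫ x in Metric.closedBall x₀ c⁻¹, ‖g x‖ := by
  have hcpt : HasCompactSupport ρ :=
    HasCompactSupport.of_support_subset_isCompact (isCompact_closedBall _ _) hρs
  have hB0 : 0 ≤ B := (abs_nonneg _).trans (hB 0)
  have hpos : ∀ t ∈ Icc c (2 * c), 0 < t := fun t ht => hc.trans_le ht.1
  have hderiv_le : ∀ t ∈ Icc c (2 * c),
      ‖t⁻¹ * ∫ x in Ω, dilationKernel (radialDivergence ρ) x₀ t x * u x‖ ≤
        c⁻¹ * ((2 * c) ^ d * B * c⁻¹ * ∫ x in Metric.closedBall x₀ c⁻¹, ‖g x‖) := fun t ht => by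
    have ht0 := hpos t ht
    have hmono : Metric.closedBall x₀ t⁻¹ ⊆ Metric.closedBall x₀ c⁻¹ :=
      Metric.closedBall_subset_closedBall (inv_anti₀ hc ht.1)
    rw [norm_mul, norm_inv, Real.norm_of_nonneg ht0.le]
    refine mul_le_mul (inv_anti₀ hc ht.1)
      ((h.abs_setIntegral_dilationKernel_radialDivergence_mul_le hu hg hρ hρs hB ht0
        (hmono.trans hball)).trans ?_) (norm_nonneg _) (by positivity)
    have hint := setIntegral_mono_set (hg.mono_set hball).norm
      (Eventually.of_forall fun x => norm_nonneg (g x)) hmono.eventuallyLE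
    gcongr
    · exact ht.2
    · exact ht.1
  have hmvt := (convex_Icc c (2 * c)).norm_image_sub_le_of_norm_hasDerivWithin_le
    (fun t ht => (hasDerivAt_integral_dilationKernel_mul (x₀ := x₀) (hρ.of_le (by simp)) hcpt hu
      (hpos t ht)).hasDerivWithinAt) hderiv_le
    (left_mem_Icc.2 (by linarith)) (right_mem_Icc.2 (by linarith))
  refine hmvt.trans_eq ?_
  rw [show 2 * c - c = c by ring, Real.norm_of_nonneg hc.le, mul_right_comm,
    inv_mul_cancel₀ hc.ne', one_mul]

end WeakGradient

section ScaleEstimate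

theorem integral_norm_le_eLpNorm_mul_rpow_of_le {α F : Type*} [MeasurableSpace α]
    [NormedAddCommGroup F] {μ ν : Measure α} [IsFiniteMeasure ν] {p : ℝ} (hp : 1 ≤ p) {f : α → F}
    (hνμ : ν ≤ μ) (hf : MemLp f (ENNReal.ofReal p) μ) :
    ∫ x, ‖f x‖ ∂ν ≤ (eLpNorm f (ENNReal.ofReal p) μ).toReal * ν.real univ ^ (1 - 1 / p) := by
  have hfν : MemLp f (ENNReal.ofReal p) ν := hf.mono_measure hνμ
  have hexp : 0 ≤ 1 - 1 / p := sub_nonneg.2 ((div_le_one (by linarith)).2 hp)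
  have hmono := ENNReal.toReal_mono hf.2.ne (eLpNorm_mono_measure f hνμ)
  have hHolder := ENNReal.toReal_mono (ENNReal.mul_ne_top hfν.2.ne
    (ENNReal.rpow_ne_top_of_nonneg hexp (measure_ne_top ν univ))) <| by
      simpa only [ENNReal.toReal_one, ENNReal.toReal_ofReal (zero_le_one.trans hp), div_one] using
        eLpNorm_le_eLpNorm_mul_rpow_measure_univ (ENNReal.one_le_ofReal.2 hp) hfν.1
  rw [ENNReal.toReal_mul, ← ENNReal.toReal_rpow, eLpNorm_one_eq_lintegral_enorm,
    ← integral_norm_eq_lintegral_enorm hfν.1] at hHolder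
  exact hHolder.trans (by gcongr; exact le_rfl)

theorem integral_mul_sub_integral_mul_eq_integral_prod {α : Type*} [MeasurableSpace α]
    {μ : Measure α} [SFinite μ] {k l u : α → ℝ} (hk : Integrable k μ) (hl : Integrable l μ)
    (hku : Integrable (fun x => k x * u x) μ) (hlu : Integrable (fun x => l x * u x) μ)
    (hk1 : ∫ x, k x ∂μ = 1) (hl1 : ∫ x, l x ∂μ = 1) :
    ∫ x, k x * u x ∂μ - ∫ x, l x * u x ∂μ =
      ∫ z, k z.1 * l z.2 * (u z.1 - u z.2) ∂μ.prod μ := by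
  calc ∫ x, k x * u x ∂μ - ∫ x, l x * u x ∂μ
      = ∫ z, k z.1 * u z.1 * l z.2 ∂μ.prod μ - ∫ z, k z.1 * (l z.2 * u z.2) ∂μ.prod μ := by
        rw [integral_prod_mul (fun x => k x * u x) l,
          integral_prod_mul k fun x => l x * u x, hk1, hl1, mul_one, one_mul]
    _ = ∫ z, k z.1 * l z.2 * (u z.1 - u z.2) ∂μ.prod μ := by
        rw [← integral_sub (hku.mul_prod hl) (hk.mul_prod hlu)]
        exact integral_congr_ae (Eventually.of_forall fun z => by ring)

variable {d : ℕ} {Ω : Set (EuclideanSpace ℝ (Fin d))} {s p : ℝ}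
  {u : EuclideanSpace ℝ (Fin d) → ℝ}

theorem aestronglyMeasurable_gagliardoQuotient {μ : Measure (EuclideanSpace ℝ (Fin d))}
    (hu : AEStronglyMeasurable u μ) :
    AEStronglyMeasurable (gagliardoQuotient s p u) (μ.prod μ) := by
  have hdist : Measurable fun z : EuclideanSpace ℝ (Fin d) × EuclideanSpace ℝ (Fin d) =>
      ‖z.1 - z.2‖ ^ ((d : ℝ) / p + s) :=
    (measurable_fst.sub measurable_snd).norm.pow_const _
  exact ((hu.comp_fst.sub hu.comp_snd).aemeasurable.div hdist.aemeasurable).aestronglyMeasurable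

theorem norm_sub_le_rpow_mul_norm_gagliardoQuotient (hsp : 0 ≤ (d : ℝ) / p + s) {δ : ℝ}
    {z : EuclideanSpace ℝ (Fin d) × EuclideanSpace ℝ (Fin d)} (hz : ‖z.1 - z.2‖ ≤ δ) :
    ‖u z.1 - u z.2‖ ≤ δ ^ ((d : ℝ) / p + s) * ‖gagliardoQuotient s p u z‖ := by
  rcases eq_or_ne z.1 z.2 with h | h
  · rw [h, sub_self, norm_zero]
    exact mul_nonneg (Real.rpow_nonneg ((norm_nonneg _).trans hz) _) (norm_nonneg _)
  · have hpos : 0 < ‖z.1 - z.2‖ := norm_pos_iff.2 (sub_ne_zero.2 h)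
    rw [gagliardoQuotient, norm_div, Real.norm_of_nonneg (Real.rpow_nonneg hpos.le _)]
    calc ‖u z.1 - u z.2‖
        = ‖z.1 - z.2‖ ^ ((d : ℝ) / p + s) *
            (‖u z.1 - u z.2‖ / ‖z.1 - z.2‖ ^ ((d : ℝ) / p + s)) := by field_simp
      _ ≤ _ := by gcongr

theorem abs_integral_mul_sub_integral_mul_le_gagliardo (hsp : 0 ≤ (d : ℝ) / p + s)
    {S : Set (EuclideanSpace ℝ (Fin d))} (hSm : MeasurableSet S)
    [IsFiniteMeasure (volume.restrict S)] {δ : ℝ} (hδ : ∀ x ∈ S, ∀ y ∈ S, ‖x - y‖ ≤ δ)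
    (hu : IntegrableOn u S)
    (hQ : Integrable (gagliardoQuotient s p u) ((volume.restrict S).prod (volume.restrict S)))
    {k l : EuclideanSpace ℝ (Fin d) → ℝ} (hk : Continuous k) (hl : Continuous l) {A : ℝ}
    (hkA : ∀ x, |k x| ≤ A) (hlA : ∀ x, |l x| ≤ A) (hk1 : ∫ x in S, k x = 1)
    (hl1 : ∫ x in S, l x = 1) :
    |(∫ x in S, k x * u x) - ∫ x in S, l x * u x| ≤ A * A * δ ^ ((d : ℝ) / p + s) *
      ∫ z, ‖gagliardoQuotient s p u z‖ ∂(volume.restrict S).prod (volume.restrict S) := by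
  have hint : ∀ {m : EuclideanSpace ℝ (Fin d) → ℝ}, Continuous m → (∀ x, |m x| ≤ A) →
      IntegrableOn m S ∧ IntegrableOn (fun x => m x * u x) S := fun hm hmA =>
    ⟨Integrable.of_bound hm.aestronglyMeasurable A (Eventually.of_forall hmA),
      hu.bdd_mul hm.aestronglyMeasurable (Eventually.of_forall hmA)⟩
  rw [integral_mul_sub_integral_mul_eq_integral_prod (hint hk hkA).1 (hint hl hlA).1
    (hint hk hkA).2 (hint hl hlA).2 hk1 hl1, ← integral_const_mul, ← Real.norm_eq_abs]
  refine norm_integral_le_of_norm_le (hQ.norm.const_mul _) ?_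
  have hmem : ∀ᵐ z ∂(volume.restrict S).prod (volume.restrict S), z ∈ S ×ˢ S := by
    rw [Measure.prod_restrict]
    exact ae_restrict_mem (hSm.prod hSm)
  filter_upwards [hmem] with z hz
  rw [norm_mul, norm_mul, mul_assoc (A * A)]
  have hA : 0 ≤ A := (abs_nonneg _).trans (hkA 0)
  gcongr
  · exact hkA _
  · exact hlA _
  · exact norm_sub_le_rpow_mul_norm_gagliardoQuotient hsp (hδ _ hz.1 _ hz.2)

theorem le_mul_toReal_sobolevSeminorm_one {X D : ℝ} (hD : 0 ≤ D)
    (hu : sobolevSeminorm Ω 1 p u ≠ ⊤)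
    (h : ∀ g, MemLp g (ENNReal.ofReal p) (volume.restrict Ω) → IsWeakGradient Ω u g →
      X ≤ D * (eLpNorm g (ENNReal.ofReal p) (volume.restrict Ω)).toReal) :
    X ≤ D * (sobolevSeminorm Ω 1 p u).toReal := by
  rw [sobolevSeminorm, if_pos rfl] at hu ⊢
  rcases hD.eq_or_lt with rfl | hD
  · simp only [← lt_top_iff_ne_top, iInf_lt_iff] at hu
    obtain ⟨g, hg, -⟩ := hu
    simpa only [zero_mul] using h g hg.1 hg.2
  · rw [← div_le_iff₀' hD, ← ENNReal.ofReal_le_iff_le_toReal hu]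
    refine le_iInf₂ fun g hg => ?_
    rw [ENNReal.ofReal_le_iff_le_toReal hg.1.2.ne, div_le_iff₀' hD]
    exact h g hg.1 hg.2

end ScaleEstimate

section Morrey

variable {d : ℕ} {Ω : Set (EuclideanSpace ℝ (Fin d))} {s p : ℝ}
  {u ρ : EuclideanSpace ℝ (Fin d) → ℝ} {x₀ : EuclideanSpace ℝ (Fin d)} {c B : ℝ}

theorem volume_real_closedBall_inv (hc : 0 < c) :
    volume.real (Metric.closedBall x₀ c⁻¹) =
      c ^ (-(d : ℝ)) * volume.real (Metric.ball (0 : EuclideanSpace ℝ (Fin d)) 1) := by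
  rw [Measure.addHaar_real_closedBall volume x₀ (inv_nonneg.2 hc.le), finrank_euclideanSpace_fin,
    inv_pow, Real.rpow_neg hc.le, Real.rpow_natCast]

theorem abs_setIntegral_dilationKernel_mul_sub_le_of_one [IsFiniteMeasure (volume.restrict Ω)]
    (hp : 1 ≤ p) (hu : IntegrableOn u Ω) (hfin : sobolevSeminorm Ω 1 p u ≠ ⊤)
    (hρ : ContDiff ℝ ∞ ρ) (hρs : Function.support ρ ⊆ Metric.closedBall 0 1)
    (hB : ∀ z, |ρ z| ≤ B) (hc : 0 < c) (hball : Metric.closedBall x₀ c⁻¹ ⊆ Ω) :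
    |(∫ x in Ω, dilationKernel ρ x₀ (2 * c) x * u x) - ∫ x in Ω, dilationKernel ρ x₀ c x * u x| ≤
      2 ^ d * B * volume.real (Metric.ball (0 : EuclideanSpace ℝ (Fin d)) 1) ^ (1 - 1 / p) *
        c ^ (d / p - 1) * (sobolevSeminorm Ω 1 p u).toReal := by
  have hB0 : 0 ≤ B := (abs_nonneg _).trans (hB 0)
  refine le_mul_toReal_sobolevSeminorm_one (by positivity) hfin fun g hg hug => ?_
  have : IsFiniteMeasure (volume.restrict (Metric.closedBall x₀ c⁻¹)) :=
    isFiniteMeasure_restrict.2 measure_closedBall_lt_top.ne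
  have hHolder := integral_norm_le_eLpNorm_mul_rpow_of_le hp
    (Measure.restrict_mono_set volume hball) hg
  rw [measureReal_restrict_apply_univ, volume_real_closedBall_inv hc] at hHolder
  refine (hug.abs_setIntegral_dilationKernel_mul_sub_le hu
    (hg.integrable (ENNReal.one_le_ofReal.2 hp)) hρ hρs hB hc hball).trans ?_
  refine (mul_le_mul_of_nonneg_left hHolder (by positivity)).trans_eq ?_
  have hpow : c ^ (d : ℝ) * c⁻¹ * (c ^ (-(d : ℝ))) ^ (1 - 1 / p) = c ^ (d / p - 1) := by
    rw [← Real.rpow_neg_one, ← Real.rpow_mul hc.le, ← Real.rpow_add hc, ← Real.rpow_add hc]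
    congr 1
    ring
  rw [← hpow, Real.mul_rpow (by positivity) (by positivity), mul_pow, Real.rpow_natCast]
  ring

theorem abs_setIntegral_dilationKernel_mul_sub_le_gagliardo (hsp : 0 ≤ (d : ℝ) / p + s)
    (hu : IntegrableOn u Ω) (hQ : Integrable (gagliardoQuotient s p u)
      ((volume.restrict (Metric.closedBall x₀ c⁻¹)).prod
        (volume.restrict (Metric.closedBall x₀ c⁻¹))))
    (hρ : Continuous ρ) (hρs : Function.support ρ ⊆ Metric.closedBall 0 1)
    (hρ1 : ∫ z, ρ z = 1) (hB : ∀ z, |ρ z| ≤ B) (hc : 0 < c)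
    (hball : Metric.closedBall x₀ c⁻¹ ⊆ Ω) :
    |(∫ x in Ω, dilationKernel ρ x₀ (2 * c) x * u x) - ∫ x in Ω, dilationKernel ρ x₀ c x * u x| ≤
      (2 * c) ^ d * B * ((2 * c) ^ d * B) * (2 * c⁻¹) ^ (d / p + s) *
        ∫ z, ‖gagliardoQuotient s p u z‖ ∂(volume.restrict (Metric.closedBall x₀ c⁻¹)).prod
          (volume.restrict (Metric.closedBall x₀ c⁻¹)) := by
  set S := Metric.closedBall x₀ c⁻¹
  have hB0 : 0 ≤ B := (abs_nonneg _).trans (hB 0)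
  have h2c : 0 < 2 * c := by positivity
  have hball2 : Metric.closedBall x₀ (2 * c)⁻¹ ⊆ S :=
    Metric.closedBall_subset_closedBall (inv_anti₀ hc (by linarith))
  have : IsFiniteMeasure (volume.restrict S) :=
    isFiniteMeasure_restrict.2 measure_closedBall_lt_top.ne
  have hdiam : ∀ x ∈ S, ∀ y ∈ S, ‖x - y‖ ≤ 2 * c⁻¹ := fun x hx y hy => by
    rw [← dist_eq_norm]
    linarith [dist_triangle_right x y x₀, Metric.mem_closedBall.1 hx, Metric.mem_closedBall.1 hy]
  have hbound : ∀ t, 0 < t → t ≤ 2 * c → ∀ x, |dilationKernel ρ x₀ t x| ≤ (2 * c) ^ d * B :=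
    fun t ht htc x => by
      refine (abs_dilationKernel_le hB ht.le x).trans ?_
      rw [finrank_euclideanSpace_fin]
      gcongr
  rw [setIntegral_dilationKernel_mul hρs h2c (hball2.trans hball),
    setIntegral_dilationKernel_mul hρs hc hball,
    ← setIntegral_dilationKernel_mul hρs h2c hball2,
    ← setIntegral_dilationKernel_mul hρs hc subset_rfl]
  exact abs_integral_mul_sub_integral_mul_le_gagliardo hsp measurableSet_closedBall hdiam
    (hu.mono_set hball) hQ (continuous_dilationKernel hρ) (continuous_dilationKernel hρ)
    (hbound _ h2c le_rfl) (hbound c hc (by linarith))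
    ((setIntegral_dilationKernel hρs h2c hball2).trans hρ1)
    ((setIntegral_dilationKernel hρs hc subset_rfl).trans hρ1)

theorem abs_setIntegral_dilationKernel_mul_sub_le_of_ne_one (hp : 1 ≤ p)
    (hs0 : 0 ≤ s) (hs1 : s ≠ 1) (hu : IntegrableOn u Ω) (hfin : sobolevSeminorm Ω s p u ≠ ⊤)
    (hρ : Continuous ρ) (hρs : Function.support ρ ⊆ Metric.closedBall 0 1)
    (hρ1 : ∫ z, ρ z = 1) (hB : ∀ z, |ρ z| ≤ B) (hc : 0 < c)
    (hball : Metric.closedBall x₀ c⁻¹ ⊆ Ω) :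
    |(∫ x in Ω, dilationKernel ρ x₀ (2 * c) x * u x) - ∫ x in Ω, dilationKernel ρ x₀ c x * u x| ≤
      (2 ^ d * B) ^ 2 * 2 ^ (d / p + s) *
        (volume.real (Metric.ball (0 : EuclideanSpace ℝ (Fin d)) 1) ^ 2) ^ (1 - 1 / p) *
        c ^ (d / p - s) * (sobolevSeminorm Ω s p u).toReal := by
  have : IsFiniteMeasure (volume.restrict (Metric.closedBall x₀ c⁻¹)) :=
    isFiniteMeasure_restrict.2 measure_closedBall_lt_top.ne
  have hB0 : 0 ≤ B := (abs_nonneg _).trans (hB 0)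
  rw [sobolevSeminorm, if_neg hs1] at hfin ⊢
  have hQ : MemLp (gagliardoQuotient s p u) (ENNReal.ofReal p)
      ((volume.restrict Ω).prod (volume.restrict Ω)) :=
    ⟨aestronglyMeasurable_gagliardoQuotient hu.1, hfin.lt_top⟩
  have hle : (volume.restrict (Metric.closedBall x₀ c⁻¹)).prod
      (volume.restrict (Metric.closedBall x₀ c⁻¹)) ≤
      (volume.restrict Ω).prod (volume.restrict Ω) := by
    rw [Measure.prod_restrict, Measure.prod_restrict]
    exact Measure.restrict_mono_set _ (prod_mono hball hball)
  have hHolder := integral_norm_le_eLpNorm_mul_rpow_of_le hp hle hQ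
  rw [← univ_prod_univ, measureReal_prod_prod, measureReal_restrict_apply_univ,
    volume_real_closedBall_inv hc] at hHolder
  refine (abs_setIntegral_dilationKernel_mul_sub_le_gagliardo (by positivity) hu
    ((hQ.mono_measure hle).integrable (ENNReal.one_le_ofReal.2 hp)) hρ hρs hρ1 hB hc hball).trans ?_
  refine (mul_le_mul_of_nonneg_left hHolder (by positivity)).trans_eq ?_
  have hpow : c ^ (d : ℝ) * c ^ (d : ℝ) * (c⁻¹) ^ (d / p + s) *
      (c ^ (-(d : ℝ)) * c ^ (-(d : ℝ))) ^ (1 - 1 / p) = c ^ (d / p - s) := by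
    rw [Real.inv_rpow hc.le, ← Real.rpow_neg hc.le, ← Real.rpow_add hc, ← Real.rpow_add hc,
      ← Real.rpow_add hc, ← Real.rpow_mul hc.le, ← Real.rpow_add hc]
    congr 1
    ring
  rw [← hpow, mul_mul_mul_comm (c ^ (-(d : ℝ))), Real.mul_rpow zero_le_two (by positivity),
    Real.mul_rpow (x := c ^ (-(d : ℝ)) * c ^ (-(d : ℝ))) (by positivity) (by positivity), mul_pow,
    Real.rpow_natCast, sq (volume.real _)]
  ring

theorem exists_abs_setIntegral_dilationKernel_mul_sub_le [IsFiniteMeasure (volume.restrict Ω)]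
    [hp : Fact (1 < p)] (hs0 : 0 ≤ s) (hρ : ContDiff ℝ ∞ ρ)
    (hρs : Function.support ρ ⊆ Metric.closedBall 0 1) (hρ1 : ∫ z, ρ z = 1)
    (x₀ : EuclideanSpace ℝ (Fin d)) :
    ∃ C, 0 ≤ C ∧ ∀ c, 0 < c → Metric.closedBall x₀ c⁻¹ ⊆ Ω → ∀ v : SobolevSpace Ω s p,
      |(∫ x in Ω, dilationKernel ρ x₀ (2 * c) x * SobolevSpace.toLp v x) -
        ∫ x in Ω, dilationKernel ρ x₀ c x * SobolevSpace.toLp v x| ≤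
      C * c ^ (d / p - s) * ‖v‖ := by
  obtain ⟨B, hB⟩ := (HasCompactSupport.of_support_subset_isCompact (isCompact_closedBall _ _)
    hρs).exists_bound_of_continuous hρ.continuous
  have hB0 : 0 ≤ B := (norm_nonneg _).trans (hB 0)
  have hseminorm := fun (v : SobolevSpace Ω s p) => SobolevSpace.toReal_seminorm_le_norm v
  rcases eq_or_ne s 1 with rfl | hs1
  · refine ⟨2 ^ d * B * volume.real (Metric.ball (0 : EuclideanSpace ℝ (Fin d)) 1) ^ (1 - 1 / p),
      by positivity, fun c hc hball v => ?_⟩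
    refine (abs_setIntegral_dilationKernel_mul_sub_le_of_one hp.out.le
      (SobolevSpace.integrable_toLp v) (SobolevSpace.seminorm_lt_top v).ne hρ hρs hB hc
      hball).trans ?_
    gcongr
    exact hseminorm v
  · refine ⟨(2 ^ d * B) ^ 2 * 2 ^ (d / p + s) *
      (volume.real (Metric.ball (0 : EuclideanSpace ℝ (Fin d)) 1) ^ 2) ^ (1 - 1 / p),
      by positivity, fun c hc hball v => ?_⟩
    refine (abs_setIntegral_dilationKernel_mul_sub_le_of_ne_one hp.out.le hs0 hs1
      (SobolevSpace.integrable_toLp v) (SobolevSpace.seminorm_lt_top v).ne hρ.continuous hρs hρ1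
      hB hc hball).trans ?_
    gcongr
    exact hseminorm v

end Morrey

section PointEvaluation

variable {d : ℕ} {Ω : Set (EuclideanSpace ℝ (Fin d))} {s p : ℝ} [Fact (1 < p)]

theorem exists_neg_mem_radialCone_integral_mul [IsFiniteMeasure (volume.restrict Ω)]
    {φ : EuclideanSpace ℝ (Fin d) → ℝ} {B : ℝ}
    (hφm : AEStronglyMeasurable φ (volume.restrict Ω)) (hφ0 : ∀ x, 0 ≤ φ x)
    (hφB : ∀ x, |φ x| ≤ B) :
    ∃ Λ : StrongDual ℝ (SobolevSpace Ω s p),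
      -Λ ∈ radialCone (unitBoundsInDual Ω s p)
        (SobolevSpace.integralDual (Lp.const ⊤ (volume.restrict Ω) 1)) ∧
      ∀ v, Λ v = ∫ x in Ω, φ x * SobolevSpace.toLp v x := by
  have hφ : MemLp φ ⊤ (volume.restrict Ω) := memLp_top_of_bound hφm B (ae_of_all _ hφB)
  refine ⟨SobolevSpace.integralDual (hφ.toLp φ),
    SobolevSpace.neg_integralDual_mem_radialCone ?_, fun v => ?_⟩
  · filter_upwards [hφ.coeFn_toLp] with x hx
    exact (hφ0 x).trans_eq hx.symm
  · rw [SobolevSpace.integralDual_apply]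
    refine integral_congr_ae ?_
    filter_upwards [hφ.coeFn_toLp] with x hx
    rw [hx]

theorem exists_smooth_probability_kernel (d : ℕ) :
    ∃ ρ : EuclideanSpace ℝ (Fin d) → ℝ, ContDiff ℝ ∞ ρ ∧ (∀ z, 0 ≤ ρ z) ∧
      Function.support ρ ⊆ Metric.closedBall 0 1 ∧ ∫ z, ρ z = 1 := by
  let b : ContDiffBump (0 : EuclideanSpace ℝ (Fin d)) := ⟨1 / 2, 1, by norm_num, by norm_num⟩
  exact ⟨b.normed volume, b.contDiff_normed, b.nonneg_normed,
    b.support_normed_eq.trans_subset Metric.ball_subset_closedBall, b.integral_normed⟩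

theorem exists_tendsto_of_eval_sub_le_rpow {V : Type*} [NormedAddCommGroup V] [NormedSpace ℝ V]
    {Λ : ℕ → StrongDual ℝ V} {C c α : ℝ} (hα : α < 0) (hC : 0 ≤ C) (hc : 0 < c)
    (h : ∀ n v, |Λ (n + 1) v - Λ n v| ≤ C * (2 ^ n * c) ^ α * ‖v‖) :
    ∃ L, Tendsto Λ atTop (𝓝 L) := by
  refine cauchySeq_tendsto_of_complete (cauchySeq_of_le_geometric (2 ^ α) (C * c ^ α)
    (Real.rpow_lt_one_of_one_lt_of_neg one_lt_two hα) fun n => ?_)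
  have hpow : C * (2 ^ n * c) ^ α = C * c ^ α * (2 ^ α) ^ n := by
    rw [Real.mul_rpow (by positivity) hc.le, ← Real.rpow_natCast, ← Real.rpow_natCast,
      ← Real.rpow_mul zero_le_two, ← Real.rpow_mul zero_le_two, mul_comm (n : ℝ)]
    ring
  rw [dist_comm, dist_eq_norm, ← hpow]
  exact ContinuousLinearMap.opNorm_le_bound _ (by positivity) (h n)

theorem exists_neg_mem_tangentCone_eval [IsFiniteMeasure (volume.restrict Ω)] (hΩ : IsOpen Ω)
    (hsp : (d : ℝ) < s * p) {x₀ : EuclideanSpace ℝ (Fin d)} (hx₀ : x₀ ∈ Ω) :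
    ∃ L : StrongDual ℝ (SobolevSpace Ω s p),
      -L ∈ tangentCone (unitBoundsInDual Ω s p)
        (SobolevSpace.integralDual (Lp.const ⊤ (volume.restrict Ω) 1)) ∧
      ∀ v f, SobolevSpace.toLp v =ᵐ[volume.restrict Ω] f → ContinuousAt f x₀ → L v = f x₀ := by
  have hp0 : 0 < p := one_pos.trans Fact.out
  have hs0 : 0 ≤ s := (pos_of_mul_pos_left ((Nat.cast_nonneg d).trans_lt hsp) hp0.le).le
  obtain ⟨ρ, hρ, hρ0, hρs, hρ1⟩ := exists_smooth_probability_kernel d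
  have hρc : HasCompactSupport ρ :=
    HasCompactSupport.of_support_subset_isCompact (isCompact_closedBall _ _) hρs
  obtain ⟨B, hB⟩ := hρc.exists_bound_of_continuous hρ.continuous
  obtain ⟨C, hC, hMorrey⟩ :=
    exists_abs_setIntegral_dilationKernel_mul_sub_le (Ω := Ω) (p := p) hs0 hρ hρs hρ1 x₀
  obtain ⟨r, hr, hball⟩ := Metric.nhds_basis_closedBall.mem_iff.1 (hΩ.mem_nhds hx₀)
  have hscale : ∀ n : ℕ, 0 < 2 ^ n * r⁻¹ := fun n => by positivity
  choose Λ hΛcone hΛ using fun n : ℕ => exists_neg_mem_radialCone_integral_mul (Ω := Ω) (s := s)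
    (p := p) (φ := dilationKernel ρ x₀ (2 ^ n * r⁻¹))
    (continuous_dilationKernel hρ.continuous).aestronglyMeasurable
    (fun x => mul_nonneg (pow_nonneg (hscale n).le _) (hρ0 _))
    (abs_dilationKernel_le hB (hscale n).le)
  have hstep : ∀ n v, |Λ (n + 1) v - Λ n v| ≤ C * (2 ^ n * r⁻¹) ^ (d / p - s) * ‖v‖ := by
    intro n v
    have hsub : Metric.closedBall x₀ (2 ^ n * r⁻¹)⁻¹ ⊆ Ω := by
      refine (Metric.closedBall_subset_closedBall ?_).trans hball
      rw [mul_inv, inv_inv]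
      exact mul_le_of_le_one_left hr.le (inv_le_one_of_one_le₀ (one_le_pow₀ one_le_two))
    rw [hΛ, hΛ, pow_succ', mul_assoc]
    exact hMorrey _ (hscale n) hsub v
  obtain ⟨L, hL⟩ := exists_tendsto_of_eval_sub_le_rpow
    (sub_neg.2 ((div_lt_iff₀ hp0).2 hsp)) hC (inv_pos.2 hr) hstep
  refine ⟨L, mem_closure_of_tendsto hL.neg (Eventually.of_forall hΛcone), fun v f hvf hf => ?_⟩
  have hc_tendsto : Tendsto (fun n : ℕ => (2 : ℝ) ^ n * r⁻¹) atTop atTop :=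
    (tendsto_pow_atTop_atTop_of_one_lt one_lt_two).atTop_mul_const (inv_pos.2 hr)
  have hmollify := (tendsto_setIntegral_dilationKernel_mul (hΩ.mem_nhds hx₀) hΩ.measurableSet
    hρ0 hρ1 hρc ((SobolevSpace.integrable_toLp v).congr hvf) hf).comp hc_tendsto
  refine tendsto_nhds_unique
    (((ContinuousLinearMap.apply ℝ ℝ v).continuous.tendsto L).comp hL) (hmollify.congr fun n => ?_)
  refine (integral_congr_ae ?_).trans (hΛ n v).symm
  filter_upwards [hvf] with x hx
  rw [hx]

theorem exists_toLp_ae_eq_min_norm_sub [IsFiniteMeasure (volume.restrict Ω)] (hd : 0 < d)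
    (hs0 : 0 ≤ s) (hs1 : s ≤ 1) (x₀ : EuclideanSpace ℝ (Fin d)) :
    ∃ v : SobolevSpace Ω s p,
      SobolevSpace.toLp v =ᵐ[volume.restrict Ω] fun x => min ‖x - x₀‖ 1 := by
  refine exists_toLp_ae_eq_of_lipschitzWith (C := 1) (M := 1) hd hs0 hs1 ?_ fun x => ?_
  · simpa only [dist_eq_norm] using (LipschitzWith.dist_left x₀).min_const 1
  · rw [Real.norm_of_nonneg (by positivity)]
    exact min_le_right _ _

theorem ae_min_norm_sub_pos (hd : 0 < d) (x₀ : EuclideanSpace ℝ (Fin d)) :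
    ∀ᵐ x ∂volume.restrict Ω, 0 < min ‖x - x₀‖ 1 := by
  have : Nonempty (Fin d) := Fin.pos_iff_nonempty.1 hd
  filter_upwards [Measure.ae_ne (volume.restrict Ω) x₀] with x hx
  exact lt_min (norm_sub_pos_iff.2 hx) one_pos

end PointEvaluation

theorem mainTheorem5_general {d : ℕ} (hd : 0 < d) {Ω : Set (EuclideanSpace ℝ (Fin d))}
    (hΩ : IsOpen Ω) (hne : Ω.Nonempty) (hfin : volume Ω ≠ ⊤) {s p : ℝ} (hs1 : s ≤ 1)
    [Fact (1 < p)] (hsp : (d : ℝ) < s * p) :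
    IsClosed (unitBoundsInDual Ω s p) ∧ Convex ℝ (unitBoundsInDual Ω s p) ∧
      (unitBoundsInDual Ω s p).Nonempty ∧ ¬ IsPolyhedric (unitBoundsInDual Ω s p) := by
  have : IsFiniteMeasure (volume.restrict Ω) := isFiniteMeasure_restrict.2 hfin
  have hw := SobolevSpace.integralDual_const_mem_unitBoundsInDual (Ω := Ω) (s := s) (p := p)
  refine ⟨SobolevSpace.isClosed_unitBoundsInDual, SobolevSpace.convex_unitBoundsInDual, ⟨_, hw⟩, ?_⟩
  have hs0 : 0 ≤ s := (pos_of_mul_pos_left ((Nat.cast_nonneg d).trans_lt hsp)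
    (zero_le_one.trans (Fact.out : 1 < p).le)).le
  obtain ⟨x₀, hx₀⟩ := hne
  obtain ⟨L, hLT, hL⟩ := exists_neg_mem_tangentCone_eval hΩ hsp hx₀
  obtain ⟨e, he⟩ : ∃ e : SobolevSpace Ω s p, SobolevSpace.toLp e =ᵐ[volume.restrict Ω] fun _ => 1 :=
    exists_toLp_ae_eq_of_lipschitzWith hd hs0 hs1 (.const 1) fun _ => norm_one.le
  obtain ⟨v, hv⟩ := exists_toLp_ae_eq_min_norm_sub (Ω := Ω) (p := p) hd hs0 hs1 x₀
  have hpos : ∀ᵐ x ∂volume.restrict Ω, 0 < SobolevSpace.toLp v x := by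
    filter_upwards [hv, ae_min_norm_sub_pos hd x₀] with x hx hx0 using hx ▸ hx0
  have hLv : L v = 0 := (hL v _ hv (by fun_prop)).trans (by simp)
  have hL0 : L ≠ 0 := fun h =>
    zero_ne_one ((DFunLike.congr_fun h e).symm.trans (hL e _ he continuousAt_const))
  refine not_isPolyhedric_of_exposed (η := ContinuousLinearMap.apply ℝ ℝ v) hw (fun ℓ hℓ => ?_)
    (fun ℓ hℓ h => ?_) hLT ?_ (neg_ne_zero.2 hL0)
  · exact (SobolevSpace.apply_le_integral_of_mem_unitBoundsInDual (hpos.mono fun _ => le_of_lt)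
      hℓ).trans_eq (SobolevSpace.integralDual_const_apply v).symm
  · exact SobolevSpace.eq_integralDual_const_of_apply_eq_integral hpos hℓ
      (h.trans (SobolevSpace.integralDual_const_apply v))
  · exact neg_eq_zero.2 hLv

theorem mainTheorem5 (d : ℕ) (hd : 0 < d) (Ω : Set (EuclideanSpace ℝ (Fin d)))
    (hΩ : IsBoundedLipschitzDomain Ω) (s p : ℝ) (hs0 : 0 < s) (hs1 : s ≤ 1)
    [Fact (1 < p)] (hsp : (d : ℝ) < s * p) :
    IsClosed (unitBoundsInDual Ω s p) ∧ Convex ℝ (unitBoundsInDual Ω s p) ∧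
      (unitBoundsInDual Ω s p).Nonempty ∧ ¬ IsPolyhedric (unitBoundsInDual Ω s p) :=
  mainTheorem5_general hd hΩ.isOpen hΩ.isConnected.nonempty hΩ.isBounded.measure_lt_top.ne hs1 hsp
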